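/- **Setting.** Let $d,K,S,N$ be integers with $1\le S<K$ and $N\ge 1$. A dictionary is a $d\times K$ real matrix $\Psi=(\psi_1,\dots,\psi_K)$; let $\mathcal D$ be the set of dictionaries with $\|\psi_k\|_2=1$ for all $k$. For $I\subseteq\{1,\dots,K\}$ let $\Psi_I$ be the matrix of the columns indexed by $I$ and $P_I(\Psi)$ the orthogonal projection onto their span. Let $\mathcal X_S$ be the set of $K\times N$ real matrices all of whose columns have at most $S$ non-zero entries. For signals $Y=(y_1,\dots,y_N)$ in $\mathbb R^d$ consider the empirical criterion $$F_Y(\Psi)=\frac1N\sum_{n=1}^N\max_{|I|\le S}\|P_I(\Psi)y_n\|_2^2\qquad(\Psi\in\mathcal D)$$ and the K-SVD cost $\|Y-\Psi X\|_F^2$, to be minimised over $\Psi\in\mathcal D$ and $X\in\mathcal X_S$. Let $\Phi=(\phi_1,\dots,\phi_K)\in\mathcal D$ be a unit norm tight frame of $\mathbb R^d$ with frame constant $A=K/d$, i.e. $\sum_i\langle\phi_i,v\rangle^2=A\|v\|_2^2$ for all $v\in\mathbb R^d$, and let $\delta_S=\max_{1\le|I|\le S}\bigl(1-\lambda_{\min}(\Phi_I^\star\Phi_I)\bigr)$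 be its lower isometry constant. Let $\nu$ be a probability distribution on the unit sphere of $\mathbb R^K$ that is symmetric, i.e. invariant under all sign changes and all permutations of the coordinates. For $x\in\mathbb R^K$ let $c_1(x)\ge\dots\ge c_K(x)\ge0$ be the non-increasing rearrangement of the absolute values of its entries; for a permutation $p$ of $\{1,\dots,K\}$ and $\sigma\in\{-1,1\}^K$ let $c_{p,\sigma}(x)$ be the vector with entries $\sigma_i c_{p(i)}(x)$, and put $I_p=p^{-1}(\{1,\dots,S\})$. Assume that there is $\kappa>0$ such that for $\nu$-almost every $x$ $$\min_{p,\sigma}\Bigl(\|P_{I_p}(\Phi)\Phi c_{p,\sigma}(x)\|_2-\max_{|I|\le S,\,I\ne I_p}\|P_I(\Phi)\Phi c_{p,\sigma}(x)\|_2\Bigr)\ge2\kappa .$$ Define $$\gamma_S^2=\mathbb E_{x\sim\nu}\bigl(c_1(x)^2+\dots+c_S(x)^2\bigr),\qquad \lambda=\frac{\gamma_S^2}{S}-\frac{1-\gamma_S^2}{K-S},\qquad C_S=\Bigl(1-\frac{S}{d(1-\delta_S)}\Bigr)^2 .$$ **Theorem.** Let $y_n=\Phi x_n$, $n=1,\dots,N$,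 with $x_1,\dots,x_N$ drawn independently from $\nu$. If for some $0<q<1/4$ $$N^{-q}+\frac{N^{-2q}}{K}\le\frac{\kappa^2(1-\delta_S)}{68\sqrt S\,\log(5AK^S/\lambda)},$$ then, except with probability at most $$\exp\Bigl(-\frac{N^{1-4q}\lambda^2S^2C_S}{4K^2A}+Kd\,\log\Bigl(\frac{NKA}{\lambda S}\Bigr)\Bigr),$$ there is $\tilde\Psi\in\mathcal D$ with $\max_k\|\tilde\psi_k-\phi_k\|_2\le2N^{-q}$ that is a local maximum of $F_Y$ on $\mathcal D$ and, respectively, a local minimum of the K-SVD cost: $\tilde\Psi$ is a local minimum on $\mathcal D$ of $\Psi\mapsto\min_{X\in\mathcal X_S}\|Y-\Psi X\|_F^2$, and for some $\tilde X\in\mathcal X_S$ minimising $\|Y-\tilde\Psi X\|_F^2$ over $X\in\mathcal X_S$ the pair $(\tilde\Psi,\tilde X)$ is a local minimum of $(\Psi,X)\mapsto\|Y-\Psi X\|_F^2$ on $\mathcal D\times\mathcal X_S$. -/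

import Mathlib

open MeasureTheory ProbabilityTheory Finset

noncomputable section

namespace KSVD

/-- `ℝⁿ` with the Euclidean norm. -/
abbrev Euc (n : ℕ) : Type := EuclideanSpace ℝ (Fin n)

/-- A `d × K` matrix, given by its `K` columns (atoms). Its topology is the product topology. -/
abbrev Dict (d K : ℕ) : Type := Fin K → Euc d

/-- The set of admissible dictionaries: all atoms have unit norm. -/
def admissible (d K : ℕ) : Set (Dict d K) := {Ψ | ∀ k, ‖Ψ k‖ = 1}

/-- `Φ` is a tight frame with frame constant `A`. -/
def IsTightFrame {d K : ℕ} (Φ : Dict d K) (A : ℝ) : Prop :=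
  0 < A ∧ ∀ v : Euc d, ∑ i, (inner ℝ (Φ i) v) ^ 2 = A * ‖v‖ ^ 2

/-- The product `Φ x = ∑ i, x i • φ i` of a dictionary with a coefficient vector. -/
def synth {d K : ℕ} (Φ : Dict d K) (x : Euc K) : Euc d := ∑ i, x i • Φ i

/-- `P_I(Φ) y`: the orthogonal projection of `y` onto the span of the atoms indexed by `I`. -/
def proj {d K : ℕ} (Φ : Dict d K) (I : Finset (Fin K)) (y : Euc d) : Euc d :=
  (Submodule.span ℝ (Φ '' (I : Set (Fin K)))).starProjection y

/-- The index sets with at most `S` elements. -/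
def smallSets (K S : ℕ) : Finset (Finset (Fin K)) := univ.filter fun I => #I ≤ S

theorem smallSets_nonempty (K S : ℕ) : (smallSets K S).Nonempty :=
  ⟨∅, by simp [smallSets]⟩

/-- `max_{|I| ≤ S} ‖P_I(Ψ) y‖²`. -/
def maxProjSq {d K : ℕ} (S : ℕ) (Ψ : Dict d K) (y : Euc d) : ℝ :=
  (smallSets K S).sup' (smallSets_nonempty K S) fun I => ‖proj Ψ I y‖ ^ 2

/-- The empirical criterion `(1/N) ∑ₙ max_{|I| ≤ S} ‖P_I(Ψ) yₙ‖²`. -/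
def empiricalCriterion {d K N : ℕ} (S : ℕ) (Y : Fin N → Euc d) (Ψ : Dict d K) : ℝ :=
  (1 / (N : ℝ)) * ∑ n, maxProjSq S Ψ (Y n)

/-- The coefficient matrices, given by their `N` columns, with at most `S` non-zero entries in
each column. -/
def sparseCoeffs (K N S : ℕ) : Set (Fin N → Euc K) :=
  {X | ∀ n, #(univ.filter fun i => X n i ≠ 0) ≤ S}

/-- `‖Y - Ψ X‖_F²`, summed over the columns. -/
def ksvdCost {d K N : ℕ} (Y : Fin N → Euc d) (Ψ : Dict d K) (X : Fin N → Euc K) : ℝ :=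
  ∑ n, ‖Y n - synth Ψ (X n)‖ ^ 2

/-- `min_{X ∈ 𝒳_S} ‖Y - Ψ X‖_F²` as a function of the dictionary `Ψ`. -/
def ksvdCriterion {d K N : ℕ} (S : ℕ) (Y : Fin N → Euc d) (Ψ : Dict d K) : ℝ :=
  ⨅ X : sparseCoeffs K N S, ksvdCost Y Ψ X

/-- The smallest eigenvalue of the Gram matrix `Φ_I^* Φ_I` (used for non-empty `I`). -/
def lambdaMin {d K : ℕ} (Φ : Dict d K) (I : Finset (Fin K)) : ℝ :=
  ⨅ j : I, (Matrix.isHermitian_gram (𝕜 := ℝ) fun i : I => Φ i).eigenvalues j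

/-- The lower isometry constant `δ_S = max_{1 ≤ |I| ≤ S} (1 - λ_min(Φ_I^* Φ_I))`. -/
def lowerIsometry {d K : ℕ} (Φ : Dict d K) (S : ℕ) : ℝ :=
  ⨆ I : {I : Finset (Fin K) // I.Nonempty ∧ #I ≤ S}, (1 - lambdaMin Φ I.1)

/-- The non-increasing rearrangement `c(x)` of the absolute values of the entries of `x`. -/
def rearr {K : ℕ} (x : Euc K) : Fin K → ℝ := fun i => |x (Tuple.sort (fun j => -|x j|) i)|

theorem rearr_antitone {K : ℕ} (x : Euc K) : Antitone (rearr x) := by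
  intro i j hij
  have h := Tuple.monotone_sort (fun j => -|x j|) hij
  simp only [Function.comp_apply] at h
  simpa [rearr] using h

/-- `c_{p,σ}`, with entries `σ_i c_{p(i)}`. -/
def signPerm {K : ℕ} (c : Fin K → ℝ) (p : Equiv.Perm (Fin K)) (σ : Fin K → ℤˣ) : Euc K :=
  WithLp.toLp 2 fun i => ((σ i : ℤ) : ℝ) * c (p i)

/-- `I_p = p⁻¹({1, …, S})` (with `0`-based indices). -/
def topSet {K : ℕ} (S : ℕ) (p : Equiv.Perm (Fin K)) : Finset (Fin K) :=
  univ.filter fun i => (p i : ℕ) < S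

/-- `ν` is invariant under all sign changes and all permutations of the coordinates. -/
def IsSymmetric {K : ℕ} (ν : Measure (Euc K)) : Prop :=
  (∀ σ : Fin K → ℤˣ,
    ν.map (fun x : Euc K => (WithLp.toLp 2 fun i => ((σ i : ℤ) : ℝ) * x i : Euc K)) = ν) ∧
  ∀ p : Equiv.Perm (Fin K), ν.map (fun x : Euc K => (WithLp.toLp 2 fun i => x (p i) : Euc K)) = ν

/-- For `ν`-almost every `x`,
`min_{p,σ} (‖P_{I_p}(Φ) Φ c_{p,σ}(x)‖ - max_{|I| ≤ S, I ≠ I_p} ‖P_I(Φ) Φ c_{p,σ}(x)‖) ≥ 2κ`. -/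
def HasMargin {d K : ℕ} (Φ : Dict d K) (S : ℕ) (ν : Measure (Euc K)) (κ : ℝ) : Prop :=
  ∀ᵐ x ∂ν, ∀ (p : Equiv.Perm (Fin K)) (σ : Fin K → ℤˣ) (I : Finset (Fin K)),
    #I ≤ S → I ≠ topSet S p →
      2 * κ ≤ ‖proj Φ (topSet S p) (synth Φ (signPerm (rearr x) p σ))‖
        - ‖proj Φ I (synth Φ (signPerm (rearr x) p σ))‖

/-- `γ_S² = 𝔼 (c₁(x)² + … + c_S(x)²)`. -/
def gammaSq {K : ℕ} (ν : Measure (Euc K)) (S : ℕ) : ℝ :=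
  ∫ x, ∑ i ∈ univ.filter (fun i : Fin K => (i : ℕ) < S), rearr x i ^ 2 ∂ν

/-- `λ_S = γ_S² / S - (1 - γ_S²) / (K - S)`. -/
def lambdaS {K : ℕ} (ν : Measure (Euc K)) (S : ℕ) : ℝ :=
  gammaSq ν S / (S : ℝ) - (1 - gammaSq ν S) / ((K : ℝ) - (S : ℝ))

/-- `C_S = (1 - S / (d (1 - δ_S)))²`. -/
def constC {d K : ℕ} (Φ : Dict d K) (S : ℕ) : ℝ :=
  (1 - (S : ℝ) / ((d : ℝ) * (1 - lowerIsometry Φ S))) ^ 2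

/-- There is an admissible dictionary `Ψ` with `max_k ‖ψ_k - φ_k‖ ≤ r` which is a local maximum
over the admissible dictionaries of the empirical criterion, and a local minimum of the K-SVD
criterion, both as a function of the dictionary alone (minimised over the coefficients) and, with
a matrix `X` of optimal coefficients, as a function of the pair `(Ψ, X)`. -/
def HasLocalOptimumWithin {d K N : ℕ} (S : ℕ) (Y : Fin N → Euc d) (Φ : Dict d K) (r : ℝ) : Prop :=
  ∃ Ψ ∈ admissible d K, (∀ k, ‖Ψ k - Φ k‖ ≤ r) ∧
    IsLocalMaxOn (empiricalCriterion S Y) (admissible d K) Ψ ∧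
    IsLocalMinOn (ksvdCriterion S Y) (admissible d K) Ψ ∧
    ∃ X ∈ sparseCoeffs K N S,
      IsMinOn (ksvdCost Y Ψ) (sparseCoeffs K N S) X ∧
      IsLocalMinOn (fun q : Dict d K × (Fin N → Euc K) => ksvdCost Y q.1 q.2)
        (admissible d K ×ˢ sparseCoeffs K N S) (Ψ, X)

end KSVD

end

/-!
The criterion `F(Ψ)` is compared with `F(Φ)` on the boundary of the set of admissible dictionaries
whose atoms are within `r = N ^ (-q) / √K` of those of `Φ`. If `F(Ψ) < F(Φ)` on this boundary, a
maximiser over the compact neighbourhood is interior, hence a local maximum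
(`hasLocalOptimumWithin_of_boundary`), and as `min_X ‖Y - Ψ X‖² = ∑ ‖y_n‖² - N F(Ψ)` it is a local
minimum of both forms of the K-SVD cost (`hasLocalOptimumWithin_of_isLocalMaxOn`).

*What the margin gives.* Almost surely `x` lies in the cell of exactly one index set `I` of size
`S`, that of its largest coefficients. By symmetry, the second moments `𝔼 x_i x_j` restricted to the
cell of `I` vanish for `i ≠ j`, and for `i = j` depend only on whether `i ∈ I`
(`cellMoment_self_eq_ite`). Quadratic functions of the signal can therefore be integrated over a
cell, the trace identity of the tight frame removing the contribution of the small coefficients.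
Integrating the margin in this way shows that any `S + 1` atoms are linearly independent, with
smallest singular value at least `√2 κ` (`boundedBelow_of_margin`), and that `4 κ² ≤ λ`.
Consequently the projections `P_I(Ψ)` are Lipschitz in `Ψ`, and since `‖Φ x‖² ≤ A ≤ K` the factor
`1 / √K` in `r` guarantees that the optimal index set of every signal is the same for `Ψ` as for
`Φ`. So `F(Φ) - F(Ψ)` is an average of independent copies of the variable `gap`.

*Drift and variance.* The mean of `gap` is `λ * drift` (`integral_gap`), where `drift` averages
`∑_{i ∈ I} ‖φ_i - P_I(Ψ) φ_i‖²` over `I`. It is at least `3 κ² r² / (4 K S)` on the boundary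
(`drift_ge`): among `S + 1` independent atoms, the displacement of one of them, being essentially
orthogonal to it, cannot be close to the spans of all the `S`-element subsets containing that atom.
The second moment of `gap` is at most a constant times `drift` itself (`integral_gap_sq_le`), so Chernoff's bound gives an exponent linear
in `drift`, that is of order `N r²` (`measureReal_sum_gap_le`).

*Union bound.* A grid provides a net of the boundary with at most `X ^ (10 K d)` points,
`X = N K A / (λ S)` (`exists_finset_net`, `two_mul_ceil_add_one_le`). The exponent obtained is at
least `11` times the one `E` of the theorem (`eleven_mul_exponent_le`). If `E ≤ K d log X` the
asserted bound is at least `1`; otherwise the factor `11` absorbs the size of the net.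
-/

namespace KSVD

/-! ### Projections onto spans of atoms -/

/-- The span of the atoms indexed by `I`. -/
abbrev atomSpan {d K : ℕ} (Φ : Dict d K) (I : Finset (Fin K)) : Submodule ℝ (Euc d) :=
  Submodule.span ℝ (Φ '' (I : Set (Fin K)))

theorem atom_mem_span {d K : ℕ} (Φ : Dict d K) {I : Finset (Fin K)} {i : Fin K} (hi : i ∈ I) :
    Φ i ∈ atomSpan Φ I :=
  Submodule.subset_span ⟨i, hi, rfl⟩

theorem sum_smul_mem_span {d K : ℕ} (Φ : Dict d K) (I : Finset (Fin K)) (a : Fin K → ℝ) :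
    ∑ k ∈ I, a k • Φ k ∈ atomSpan Φ I :=
  Submodule.sum_mem _ fun _ hk => Submodule.smul_mem _ _ (atom_mem_span Φ hk)

theorem exists_coeff {d K : ℕ} {Φ : Dict d K} {I : Finset (Fin K)} {v : Euc d}
    (hv : v ∈ atomSpan Φ I) : ∃ a : Fin K → ℝ, v = ∑ k ∈ I, a k • Φ k := by
  obtain ⟨c, hc⟩ := (Submodule.mem_span_image_finset_iff_exists_fun ℝ).1 hv
  refine ⟨fun k => if h : k ∈ I then c ⟨k, h⟩ else 0, ?_⟩
  rw [← hc, ← Finset.sum_attach I fun k => (if h : k ∈ I then c ⟨k, h⟩ else 0) • Φ k]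
  exact Finset.sum_congr rfl fun k _ => by simp [k.2]

theorem atomSpan_mono {d K : ℕ} (Φ : Dict d K) {I J : Finset (Fin K)} (h : I ⊆ J) :
    atomSpan Φ I ≤ atomSpan Φ J :=
  Submodule.span_mono (Set.image_mono (by exact_mod_cast h))

/-- `proj Φ I` as a linear map. -/
noncomputable abbrev projL {d K : ℕ} (Φ : Dict d K) (I : Finset (Fin K)) : Euc d →ₗ[ℝ] Euc d :=
  ((atomSpan Φ I).starProjection : Euc d →ₗ[ℝ] Euc d)

theorem projL_apply {d K : ℕ} (Φ : Dict d K) (I : Finset (Fin K)) (y : Euc d) :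
    projL Φ I y = proj Φ I y := rfl

section proj

variable {d K : ℕ} (Φ : Dict d K) (I : Finset (Fin K))

theorem proj_add (y z : Euc d) : proj Φ I (y + z) = proj Φ I y + proj Φ I z :=
  map_add (projL Φ I) y z

theorem proj_sub (y z : Euc d) : proj Φ I (y - z) = proj Φ I y - proj Φ I z :=
  map_sub (projL Φ I) y z

theorem proj_mem (y : Euc d) : proj Φ I y ∈ atomSpan Φ I :=
  Submodule.starProjection_apply_mem _ _

theorem proj_of_mem {v : Euc d} (hv : v ∈ atomSpan Φ I) : proj Φ I v = v :=
  Submodule.starProjection_eq_self_iff.2 hv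

theorem proj_proj (y : Euc d) : proj Φ I (proj Φ I y) = proj Φ I y :=
  proj_of_mem Φ I (proj_mem Φ I y)

theorem inner_proj_left (y z : Euc d) : inner ℝ (proj Φ I y) z = inner ℝ y (proj Φ I z) :=
  Submodule.inner_starProjection_left_eq_right _ _ _

theorem inner_proj_self (y : Euc d) : inner ℝ y (proj Φ I y) = ‖proj Φ I y‖ ^ 2 := by
  rw [← proj_proj, ← inner_proj_left, real_inner_self_eq_norm_sq, proj_proj]

theorem inner_sub_proj {v : Euc d} (hv : v ∈ atomSpan Φ I) (y : Euc d) :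
    inner ℝ v (y - proj Φ I y) = 0 := by
  rw [real_inner_comm]
  exact Submodule.starProjection_inner_eq_zero _ _ hv

theorem norm_sq_eq_proj (y : Euc d) :
    ‖y‖ ^ 2 = ‖proj Φ I y‖ ^ 2 + ‖y - proj Φ I y‖ ^ 2 := by
  have h := norm_add_sq_real (proj Φ I y) (y - proj Φ I y)
  rw [inner_sub_proj Φ I (proj_mem Φ I y)] at h
  simpa using h

theorem norm_proj_le (y : Euc d) : ‖proj Φ I y‖ ≤ ‖y‖ :=
  Submodule.norm_starProjection_apply_le _ _

theorem norm_sub_sq_of_mem {v : Euc d} (hv : v ∈ atomSpan Φ I) (y : Euc d) :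
    ‖y - v‖ ^ 2 = ‖y - proj Φ I y‖ ^ 2 + ‖proj Φ I y - v‖ ^ 2 := by
  have h := norm_add_sq_real (y - proj Φ I y) (proj Φ I y - v)
  rw [real_inner_comm, inner_sub_proj Φ I (Submodule.sub_mem _ (proj_mem Φ I y) hv)] at h
  simpa using h

theorem norm_sub_proj_le_of_mem {v : Euc d} (hv : v ∈ atomSpan Φ I) (y : Euc d) :
    ‖y - proj Φ I y‖ ≤ ‖y - v‖ := by
  have := norm_sub_sq_of_mem Φ I hv y
  refine le_of_abs_le (abs_le_of_sq_le_sq ?_ (norm_nonneg _))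
  linarith [sq_nonneg ‖proj Φ I y - v‖]

theorem norm_sub_proj_le (y : Euc d) : ‖y - proj Φ I y‖ ≤ ‖y‖ := by
  simpa using norm_sub_proj_le_of_mem Φ I (Submodule.zero_mem _) y

end proj

/-! ### Perturbation of the projections -/

/-- Any `m` atoms are linearly independent, with smallest singular value at least `s`. -/
def BoundedBelow {d K : ℕ} (Φ : Dict d K) (m : ℕ) (s : ℝ) : Prop :=
  ∀ T : Finset (Fin K), #T ≤ m → ∀ a : Fin K → ℝ,
    s ^ 2 * ∑ k ∈ T, a k ^ 2 ≤ ‖∑ k ∈ T, a k • Φ k‖ ^ 2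

theorem BoundedBelow.mono {d K m n : ℕ} {Φ : Dict d K} {s : ℝ} (h : BoundedBelow Φ n s)
    (hmn : m ≤ n) : BoundedBelow Φ m s :=
  fun T hT a => h T (hT.trans hmn) a

theorem norm_sum_smul_le {d K : ℕ} {Θ : Dict d K} {r : ℝ} (hr : 0 ≤ r) (h : ∀ k, ‖Θ k‖ ≤ r)
    (T : Finset (Fin K)) (a : Fin K → ℝ) :
    ‖∑ k ∈ T, a k • Θ k‖ ≤ r * √(#T : ℝ) * √(∑ k ∈ T, a k ^ 2) := by
  have h1 : ‖∑ k ∈ T, a k • Θ k‖ ≤ r * ∑ k ∈ T, |a k| := by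
    refine (norm_sum_le _ _).trans ?_
    rw [Finset.mul_sum]
    refine Finset.sum_le_sum fun k _ => ?_
    rw [norm_smul, Real.norm_eq_abs, mul_comm]
    exact mul_le_mul_of_nonneg_right (h k) (abs_nonneg _)
  have h2 : ∑ k ∈ T, |a k| ≤ √(#T : ℝ) * √(∑ k ∈ T, a k ^ 2) := by
    rw [← Real.sqrt_mul (by positivity)]
    refine Real.le_sqrt_of_sq_le ?_
    have := sq_sum_le_card_mul_sum_sq (s := T) (f := fun k => |a k|)
    simpa using this
  calc _ ≤ _ := h1
    _ ≤ r * (√(#T : ℝ) * √(∑ k ∈ T, a k ^ 2)) := mul_le_mul_of_nonneg_left h2 hr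
    _ = _ := by ring

theorem BoundedBelow.perturb {d K m : ℕ} {Φ Ψ : Dict d K} {s s₀ r : ℝ}
    (hΦ : BoundedBelow Φ m s₀) (hs : 0 ≤ s) (hr : 0 ≤ r) (h : ∀ k, ‖Ψ k - Φ k‖ ≤ r)
    (hsr : s + r * √(m : ℝ) ≤ s₀) : BoundedBelow Ψ m s := by
  intro T hT a
  set x := √(∑ k ∈ T, a k ^ 2) with hx
  have hx2 : ∑ k ∈ T, a k ^ 2 = x ^ 2 := (Real.sq_sqrt (by positivity)).symm
  have hs₀ : 0 ≤ s₀ := le_trans (by positivity) hsr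
  have h1 : s₀ * x ≤ ‖∑ k ∈ T, a k • Φ k‖ := by
    refine le_of_abs_le (abs_le_of_sq_le_sq ?_ (norm_nonneg _))
    have := hΦ T hT a
    rw [hx2] at this
    nlinarith
  have h2 := norm_sum_smul_le (Θ := fun k => Ψ k - Φ k) hr h T a
  have h3 : ∑ k ∈ T, a k • (Ψ k - Φ k) = ∑ k ∈ T, a k • Ψ k - ∑ k ∈ T, a k • Φ k := by
    simp [smul_sub]
  rw [h3] at h2
  have h4 : √(#T : ℝ) ≤ √(m : ℝ) := Real.sqrt_le_sqrt (by exact_mod_cast hT)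
  have h5 := norm_sub_norm_le (∑ k ∈ T, a k • Φ k) (∑ k ∈ T, a k • Ψ k)
  rw [norm_sub_rev] at h5
  have hx0 : 0 ≤ x := Real.sqrt_nonneg _
  have h6 : r * √(#T : ℝ) * x ≤ r * √(m : ℝ) * x := by gcongr
  have h7 : s * x ≤ ‖∑ k ∈ T, a k • Ψ k‖ := by nlinarith
  rw [hx2, ← mul_pow]
  exact pow_le_pow_left₀ (by positivity) h7 2

/-- The projection onto the perturbed span moves a vector of the original span little. -/
theorem norm_sub_proj_le_of_mem_span {d K m : ℕ} {Φ Ψ : Dict d K} {s r : ℝ}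
    (hΦ : BoundedBelow Φ m s) (hs : 0 ≤ s) (hr : 0 ≤ r) (h : ∀ k, ‖Ψ k - Φ k‖ ≤ r)
    {I : Finset (Fin K)} (hI : #I ≤ m) {v : Euc d} (hv : v ∈ atomSpan Φ I) :
    s * ‖v - proj Ψ I v‖ ≤ r * √(m : ℝ) * ‖v‖ := by
  obtain ⟨a, rfl⟩ := exists_coeff hv
  set x := √(∑ k ∈ I, a k ^ 2) with hx
  have hx2 : ∑ k ∈ I, a k ^ 2 = x ^ 2 := (Real.sq_sqrt (by positivity)).symm
  have h1 : s * x ≤ ‖∑ k ∈ I, a k • Φ k‖ := by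
    refine le_of_abs_le (abs_le_of_sq_le_sq ?_ (norm_nonneg _))
    have := hΦ I hI a
    rw [hx2] at this
    nlinarith
  have h2 := norm_sub_proj_le_of_mem Ψ I (sum_smul_mem_span Ψ I a) (∑ k ∈ I, a k • Φ k)
  have h3 : ∑ k ∈ I, a k • Φ k - ∑ k ∈ I, a k • Ψ k = ∑ k ∈ I, a k • (Φ k - Ψ k) := by
    simp [smul_sub]
  have h4 := norm_sum_smul_le (Θ := fun k => Φ k - Ψ k) hr
    (fun k => by simpa [norm_sub_rev] using h k) I a
  have h5 : √(#I : ℝ) ≤ √(m : ℝ) := Real.sqrt_le_sqrt (by exact_mod_cast hI)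
  rw [h3] at h2
  have h6 : r * √(#I : ℝ) * x ≤ r * √(m : ℝ) * x := by gcongr
  calc _ ≤ s * (r * √(m : ℝ) * x) := mul_le_mul_of_nonneg_left (h2.trans (h4.trans h6)) hs
    _ = r * √(m : ℝ) * (s * x) := by ring
    _ ≤ _ := by gcongr

/-- `P - P' = P Q' - Q P'`, where `Q = 1 - P` and `Q' = 1 - P'`; both terms are small. -/
theorem norm_proj_sub_proj_le {d K m : ℕ} {Φ Ψ : Dict d K} {s r : ℝ}
    (hΦ : BoundedBelow Φ m s) (hΨ : BoundedBelow Ψ m s) (hs : 0 < s) (hr : 0 ≤ r)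
    (h : ∀ k, ‖Ψ k - Φ k‖ ≤ r) {I : Finset (Fin K)} (hI : #I ≤ m) (y : Euc d) :
    s * ‖proj Φ I y - proj Ψ I y‖ ≤ 2 * r * √(m : ℝ) * ‖y‖ := by
  set u := y - proj Ψ I y with hu
  set w := proj Φ I u with hw
  have hu' : ‖u‖ ≤ ‖y‖ := norm_sub_proj_le Ψ I y
  have h1 : s * ‖w‖ ≤ r * √(m : ℝ) * ‖y‖ := by
    have e : ‖w‖ ^ 2 = inner ℝ (w - proj Ψ I w) u := by
      rw [inner_sub_left, inner_proj_left Ψ]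
      have : proj Ψ I u = 0 := by rw [hu, proj_sub, proj_proj, sub_self]
      rw [this, inner_zero_right, sub_zero, real_inner_comm, inner_proj_self]
    have h2 := norm_sub_proj_le_of_mem_span hΦ hs.le hr h hI (proj_mem Φ I u)
    have h3 := real_inner_le_norm (w - proj Ψ I w) u
    rw [← e] at h3
    rcases eq_or_lt_of_le (norm_nonneg w) with h0 | h0
    · rw [← h0]; simp; positivity
    · refine le_of_mul_le_mul_right ?_ h0
      calc s * ‖w‖ * ‖w‖ = s * ‖w‖ ^ 2 := by ring
        _ ≤ s * (‖w - proj Ψ I w‖ * ‖u‖) := by gcongr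
        _ = s * ‖w - proj Ψ I w‖ * ‖u‖ := by ring
        _ ≤ r * √(m : ℝ) * ‖w‖ * ‖u‖ := by gcongr
        _ ≤ r * √(m : ℝ) * ‖w‖ * ‖y‖ := by gcongr
        _ = _ := by ring
  set v := proj Ψ I y with hv
  have h4 : s * ‖v - proj Φ I v‖ ≤ r * √(m : ℝ) * ‖y‖ := by
    have h2 := norm_sub_proj_le_of_mem_span (Ψ := Φ) hΨ hs.le hr
      (fun k => by rw [norm_sub_rev]; exact h k) hI (proj_mem Ψ I y)
    refine h2.trans ?_
    gcongr
    exact norm_proj_le Ψ I y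
  have e : proj Φ I y - v = w - (v - proj Φ I v) := by
    rw [hw, hu, proj_sub]; abel
  rw [e]
  calc s * ‖w - (v - proj Φ I v)‖ ≤ s * (‖w‖ + ‖v - proj Φ I v‖) := by
        gcongr; exact norm_sub_le _ _
    _ ≤ _ := by linarith

/-- The lower frame bound on the span of a subset of the atoms. -/
theorem BoundedBelow.le_sum_inner_sq {d K m : ℕ} {Φ : Dict d K} {s : ℝ}
    (hΦ : BoundedBelow Φ m s) {I : Finset (Fin K)} (hI : #I ≤ m) {v : Euc d}
    (hv : v ∈ atomSpan Φ I) : s ^ 2 * ‖v‖ ^ 2 ≤ ∑ i ∈ I, (inner ℝ (Φ i) v) ^ 2 := by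
  obtain ⟨a, ha⟩ := exists_coeff hv
  have h1 := hΦ I hI a
  rw [← ha] at h1
  have h2 : ‖v‖ ^ 2 = ∑ i ∈ I, a i * inner ℝ (Φ i) v := by
    rw [← real_inner_self_eq_norm_sq]
    conv_lhs => enter [2]; rw [ha]
    simp [inner_sum, inner_smul_right, real_inner_comm]
  have h3 := Finset.sum_mul_sq_le_sq_mul_sq I a fun i => inner ℝ (Φ i) v
  rw [← h2] at h3
  rcases eq_or_lt_of_le (norm_nonneg v) with h0 | h0
  · rw [← h0]; simp; positivity
  · have hv2 : 0 < ‖v‖ ^ 2 := by positivity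
    refine le_of_mul_le_mul_right ?_ hv2
    have hG : 0 ≤ ∑ i ∈ I, (inner ℝ (Φ i) v) ^ 2 := by positivity
    nlinarith [mul_le_mul_of_nonneg_right h1 hG, sq_nonneg s]

theorem BoundedBelow.finrank_atomSpan {d K m : ℕ} {Φ : Dict d K} {s : ℝ}
    (hΦ : BoundedBelow Φ m s) (hs : 0 < s) {I : Finset (Fin K)} (hI : #I ≤ m) :
    Module.finrank ℝ (atomSpan Φ I) = #I := by
  have hli : LinearIndepOn ℝ Φ (I : Set (Fin K)) := by
    rw [linearIndepOn_finset_iff]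
    intro a ha i hi
    have h1 := hΦ I hI a
    rw [ha] at h1
    have h2 : a i ^ 2 ≤ ∑ k ∈ I, a k ^ 2 :=
      Finset.single_le_sum (f := fun k => a k ^ 2) (fun k _ => sq_nonneg _) hi
    have h3 : ∑ k ∈ I, a k ^ 2 ≤ 0 := by
      by_contra! hc
      have : 0 < s ^ 2 * ∑ k ∈ I, a k ^ 2 := by positivity
      simp at h1
      linarith
    nlinarith [sq_nonneg (a i)]
  have := finrank_span_set_eq_card (R := ℝ) (s := Φ '' (I : Set (Fin K))) hli.id_image
  rw [atomSpan, this, Set.toFinset_card, ← Nat.card_eq_fintype_card]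
  rw [Nat.card_image_of_injOn hli.injOn]
  simp

/-! ### Traces along a tight frame -/

theorem IsTightFrame.sum_inner_mul_inner {d K : ℕ} {Φ : Dict d K} {A : ℝ}
    (hΦ : IsTightFrame Φ A) (u v : Euc d) :
    ∑ k, inner ℝ (Φ k) u * inner ℝ (Φ k) v = A * inner ℝ u v := by
  have h1 := hΦ.2 (u + v)
  have h2 := hΦ.2 u
  have h3 := hΦ.2 v
  rw [norm_add_sq_real] at h1
  simp only [inner_add_right, add_sq, Finset.sum_add_distrib, mul_assoc, ← Finset.mul_sum] at h1
  linarith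

/-- Up to the frame constant, a tight frame computes traces like an orthonormal basis. -/
theorem IsTightFrame.sum_inner_map {d K : ℕ} {Φ : Dict d K} {A : ℝ}
    (hΦ : IsTightFrame Φ A) (T : Euc d →ₗ[ℝ] Euc d) :
    ∑ k, inner ℝ (Φ k) (T (Φ k)) = A * LinearMap.trace ℝ (Euc d) T := by
  let b := EuclideanSpace.basisFun (Fin d) ℝ
  rw [LinearMap.trace_eq_sum_inner T b, Finset.mul_sum]
  simp_rw [← hΦ.sum_inner_mul_inner]
  rw [Finset.sum_comm]
  refine Finset.sum_congr rfl fun k _ => ?_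
  have h1 : T (Φ k) = ∑ j, inner ℝ (b j) (Φ k) • T (b j) := by
    conv_lhs => rw [← b.sum_repr' (Φ k)]
    simp
  rw [h1, inner_sum]
  refine Finset.sum_congr rfl fun j _ => ?_
  rw [inner_smul_right, real_inner_comm (b j)]

theorem trace_projL {d K : ℕ} (Φ : Dict d K) (I : Finset (Fin K)) :
    LinearMap.trace ℝ (Euc d) (projL Φ I) = Module.finrank ℝ (atomSpan Φ I) := by
  refine LinearMap.IsProj.trace (p := atomSpan Φ I) ⟨fun x => proj_mem Φ I x, fun x hx => ?_⟩
  exact proj_of_mem Φ I hx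

theorem IsTightFrame.sum_norm_proj_sq {d K : ℕ} {Φ Ψ : Dict d K} {A : ℝ}
    (hΦ : IsTightFrame Φ A) (I : Finset (Fin K)) :
    ∑ k, ‖proj Ψ I (Φ k)‖ ^ 2 = A * Module.finrank ℝ (atomSpan Ψ I) := by
  rw [← trace_projL, ← hΦ.sum_inner_map]
  exact Finset.sum_congr rfl fun k _ => (inner_proj_self Ψ I (Φ k)).symm

/-- Up to the factor `A`, the sum `∑ ‖P φ_k - P' φ_k‖²` is the squared Hilbert-Schmidt norm of
`P - P'`, for the projections `P` and `P'` onto the spans of the `φ_i` and the `ψ_i`, `i ∈ I`. As the ranks agree, it is twice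
that of `P (1 - P')`, which the lower frame bound on the range of `P` controls by the energy that
`P'` misses in the atoms of `I`. -/
theorem IsTightFrame.sum_norm_proj_sub_proj_sq_le {d K m : ℕ} {Φ Ψ : Dict d K} {A s : ℝ}
    (hΦ : IsTightFrame Φ A) (hb : BoundedBelow Φ m s)
    {I : Finset (Fin K)} (hI : #I ≤ m)
    (hrank : Module.finrank ℝ (atomSpan Φ I) = Module.finrank ℝ (atomSpan Ψ I)) :
    s ^ 2 * ∑ k, ‖proj Φ I (Φ k) - proj Ψ I (Φ k)‖ ^ 2 ≤
      2 * A * ∑ i ∈ I, ‖Φ i - proj Ψ I (Φ i)‖ ^ 2 := by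
  -- The next two identities are instances of `tr (S T) = tr (T S)`.
  have hcomm : ∑ k, inner ℝ (Φ k) (proj Φ I (proj Ψ I (Φ k))) =
      ∑ k, inner ℝ (Φ k) (proj Ψ I (proj Φ I (Φ k))) := by
    have h1 := hΦ.sum_inner_map (projL Φ I * projL Ψ I)
    have h2 := hΦ.sum_inner_map (projL Ψ I * projL Φ I)
    rw [LinearMap.trace_mul_comm] at h1
    exact h1.trans h2.symm
  have hPP : ∑ k, inner ℝ (Φ k) (proj Ψ I (proj Φ I (proj Ψ I (Φ k)))) =
      ∑ k, inner ℝ (Φ k) (proj Φ I (proj Ψ I (Φ k))) := by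
    have h1 := hΦ.sum_inner_map (projL Ψ I * (projL Φ I * projL Ψ I))
    have h2 := hΦ.sum_inner_map (projL Φ I * projL Ψ I)
    rw [LinearMap.trace_mul_comm, mul_assoc] at h1
    have h3 : projL Ψ I * projL Ψ I = projL Ψ I :=
      LinearMap.ext fun x => proj_proj Ψ I x
    rw [h3] at h1
    exact h1.trans h2.symm
  have hPeq : ∑ k, ‖proj Φ I (Φ k)‖ ^ 2 = ∑ k, ‖proj Ψ I (Φ k)‖ ^ 2 := by
    rw [hΦ.sum_norm_proj_sq, hΦ.sum_norm_proj_sq, hrank]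
  have hleft : ∑ k, ‖proj Φ I (Φ k) - proj Ψ I (Φ k)‖ ^ 2 =
      2 * ∑ k, ‖proj Φ I (Φ k - proj Ψ I (Φ k))‖ ^ 2 := by
    have e1 : ∀ k, ‖proj Φ I (Φ k) - proj Ψ I (Φ k)‖ ^ 2 = ‖proj Φ I (Φ k)‖ ^ 2
        - inner ℝ (Φ k) (proj Φ I (proj Ψ I (Φ k)))
        - inner ℝ (Φ k) (proj Ψ I (proj Φ I (Φ k))) + ‖proj Ψ I (Φ k)‖ ^ 2 := by
      intro k
      rw [norm_sub_sq_real, ← inner_proj_left Φ I (Φ k), ← inner_proj_left Ψ I (Φ k),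
        real_inner_comm (proj Φ I (Φ k)) (proj Ψ I (Φ k))]
      ring
    have e2 : ∀ k, ‖proj Φ I (Φ k - proj Ψ I (Φ k))‖ ^ 2 = ‖proj Φ I (Φ k)‖ ^ 2
        - 2 * inner ℝ (Φ k) (proj Φ I (proj Ψ I (Φ k)))
        + inner ℝ (Φ k) (proj Ψ I (proj Φ I (proj Ψ I (Φ k)))) := by
      intro k
      rw [proj_sub, norm_sub_sq_real, inner_proj_left Φ, proj_proj, ← inner_proj_self,
        ← inner_proj_self Φ I (proj Ψ I (Φ k)), ← inner_proj_left Ψ]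
    simp only [e1, e2, Finset.sum_add_distrib, Finset.sum_sub_distrib, ← Finset.mul_sum]
    rw [hPP, ← hcomm, ← hPeq]
    ring
  rw [hleft]
  have hkey : ∀ k, s ^ 2 * ‖proj Φ I (Φ k - proj Ψ I (Φ k))‖ ^ 2 ≤
      ∑ i ∈ I, (inner ℝ (Φ k) (Φ i - proj Ψ I (Φ i))) ^ 2 := by
    intro k
    refine (hb.le_sum_inner_sq hI (proj_mem Φ I _)).trans (le_of_eq ?_)
    refine Finset.sum_congr rfl fun i hi => ?_
    rw [← inner_proj_left, proj_of_mem Φ I (atom_mem_span Φ hi), inner_sub_right,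
      ← inner_proj_left, ← inner_sub_left, real_inner_comm]
  calc _ = 2 * ∑ k, s ^ 2 * ‖proj Φ I (Φ k - proj Ψ I (Φ k))‖ ^ 2 := by
        rw [← Finset.mul_sum]; ring
    _ ≤ 2 * ∑ k, ∑ i ∈ I, (inner ℝ (Φ k) (Φ i - proj Ψ I (Φ i))) ^ 2 := by
        gcongr with k; exact hkey k
    _ = _ := by
        rw [Finset.sum_comm]
        simp_rw [hΦ.2, ← Finset.mul_sum]
        ring

/-- The synthesis operator of a tight frame has norm at most `√A`. -/
theorem IsTightFrame.norm_synth_sq_le {d K : ℕ} {Φ : Dict d K} {A : ℝ}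
    (hΦ : IsTightFrame Φ A) (x : Euc K) : ‖synth Φ x‖ ^ 2 ≤ A * ‖x‖ ^ 2 := by
  set y := synth Φ x with hy
  have h1 : ‖y‖ ^ 2 = ∑ i, x i * inner ℝ (Φ i) y := by
    rw [← real_inner_self_eq_norm_sq]
    conv_lhs => enter [2]; rw [hy, synth]
    simp [inner_sum, inner_smul_right, real_inner_comm]
  have h2 := Finset.sum_mul_sq_le_sq_mul_sq univ (fun i => x i) fun i => inner ℝ (Φ i) y
  rw [← h1, hΦ.2, ← EuclideanSpace.real_norm_sq_eq] at h2
  rcases eq_or_lt_of_le (norm_nonneg y) with h0 | h0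
  · rw [← h0]; simp; have := hΦ.1; positivity
  · have : 0 < ‖y‖ ^ 2 := by positivity
    refine le_of_mul_le_mul_right ?_ this
    nlinarith


/-! ### Second moments of a symmetric law on the cells -/

/-- The coefficient vectors whose largest entries, in absolute value, are strictly the ones
indexed by `I`. -/
def cell {K : ℕ} (I : Finset (Fin K)) : Set (Euc K) :=
  {x | ∀ i ∈ I, ∀ j ∉ I, |x j| < |x i|}

theorem measurableSet_cell {K : ℕ} (I : Finset (Fin K)) : MeasurableSet (cell I) := by
  have : cell I = ⋂ i ∈ I, ⋂ j ∈ (Iᶜ : Finset (Fin K)), {x : Euc K | |x j| < |x i|} := by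
    ext x; simp [cell]
  rw [this]
  refine Finset.measurableSet_biInter _ fun i _ => Finset.measurableSet_biInter _ fun j _ => ?_
  exact measurableSet_lt (by fun_prop) (by fun_prop)

theorem eq_of_mem_cell {K : ℕ} {I J : Finset (Fin K)} (hIJ : #I = #J) {x : Euc K}
    (hI : x ∈ cell I) (hJ : x ∈ cell J) : I = J := by
  by_contra hne
  have h1 : ¬ I ⊆ J := fun h => hne (Finset.eq_of_subset_of_card_le h hIJ.ge)
  have h2 : ¬ J ⊆ I := fun h => hne (Finset.eq_of_subset_of_card_le h hIJ.le).symm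
  obtain ⟨i, hi, hi'⟩ := Finset.not_subset.1 h1
  obtain ⟨j, hj, hj'⟩ := Finset.not_subset.1 h2
  exact lt_asymm (hI i hi j hj') (hJ j hj i hi')

/-- The second moment of the coefficients `i` and `j` on the cell of `I`. -/
noncomputable def cellMoment {K : ℕ} (ν : Measure (Euc K)) (I : Finset (Fin K)) (i j : Fin K) :
    ℝ :=
  ∫ x in cell I, x i * x j ∂ν

theorem cellMoment_self_nonneg {K : ℕ} (ν : Measure (Euc K)) (I : Finset (Fin K)) (i : Fin K) :
    0 ≤ cellMoment ν I i i :=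
  integral_nonneg fun x => mul_self_nonneg (x i)

theorem IsSymmetric.cellMoment_eq_zero {K : ℕ} {ν : Measure (Euc K)} (h : IsSymmetric ν)
    (I : Finset (Fin K)) {i j : Fin K} (hij : i ≠ j) : cellMoment ν I i j = 0 := by
  classical
  -- Flipping the sign of the coefficient `i` preserves `ν` and the cell, but negates `x i * x j`.
  let σ : Fin K → ℤˣ := Function.update 1 i (-1)
  let g : Euc K → Euc K := fun x => WithLp.toLp 2 fun k => ((σ k : ℤ) : ℝ) * x k
  have hg : Measurable g := by fun_prop
  have hσ : ∀ k, |((σ k : ℤ) : ℝ)| = 1 := fun k => by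
    rcases Int.units_eq_one_or (σ k) with h | h <;> simp [h]
  have hcell : g ⁻¹' cell I = cell I := by
    ext x
    simp [cell, g, abs_mul, hσ]
  have h1 : cellMoment ν I i j = -cellMoment ν I i j := by
    conv_lhs => rw [cellMoment, ← h.1 σ]
    rw [setIntegral_map (measurableSet_cell I) (by fun_prop) hg.aemeasurable, hcell, cellMoment,
      ← integral_neg]
    refine integral_congr_ae (Filter.Eventually.of_forall fun x => ?_)
    simp [g, σ, Function.update_of_ne hij.symm]
  linarith

theorem IsSymmetric.cellMoment_map {K : ℕ} {ν : Measure (Euc K)} (h : IsSymmetric ν)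
    (p : Equiv.Perm (Fin K)) (I : Finset (Fin K)) (i j : Fin K) :
    cellMoment ν (I.map p.toEmbedding) (p i) (p j) = cellMoment ν I i j := by
  let g : Euc K → Euc K := fun x => WithLp.toLp 2 fun k => x (p k)
  have hg : Measurable g := by fun_prop
  have hcell : g ⁻¹' cell I = cell (I.map p.toEmbedding) := by
    ext x
    simp only [cell, Set.mem_preimage, Set.mem_ofPred_eq, g]
    constructor
    · intro hx i hi j hj
      simp only [Finset.mem_map_equiv] at hi hj
      simpa using hx _ hi _ hj
    · intro hx i hi j hj
      exact hx (p i) (by simpa using hi) (p j) (by simpa using hj)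
  conv_rhs => rw [cellMoment, ← h.2 p]
  rw [setIntegral_map (measurableSet_cell I) (by fun_prop) hg.aemeasurable, hcell, cellMoment]

theorem exists_perm_map_eq {K : ℕ} {I J : Finset (Fin K)} (hIJ : #I = #J) {i j : Fin K}
    (hij : i ∈ I ↔ j ∈ J) : ∃ p : Equiv.Perm (Fin K), I.map p.toEmbedding = J ∧ p i = j := by
  classical
  let e : {x // x ∈ I} ≃ {x // x ∈ J} := Finset.equivOfCardEq hIJ
  let p₀ : Equiv.Perm (Fin K) := e.extendSubtype
  have h₀ : ∀ x, p₀ x ∈ J ↔ x ∈ I := fun x =>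
    ⟨fun hx => by_contra fun hx' => e.extendSubtype_not_mem x hx' hx,
      fun hx => e.extendSubtype_mem x hx⟩
  let p := p₀.trans (Equiv.swap (p₀ i) j)
  have hswap : ∀ y, Equiv.swap (p₀ i) j y ∈ J ↔ y ∈ J := by
    intro y
    have h1 : p₀ i ∈ J ↔ j ∈ J := (h₀ i).trans hij
    rcases eq_or_ne y (p₀ i) with rfl | hy
    · simp [h1]
    · rcases eq_or_ne y j with rfl | hy'
      · simp [h1]
      · rw [Equiv.swap_apply_of_ne_of_ne hy hy']
  have hp : ∀ x, p x ∈ J ↔ x ∈ I := fun x => (hswap _).trans (h₀ x)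
  refine ⟨p, ?_, by simp [p]⟩
  ext y
  rw [Finset.mem_map_equiv, ← hp, Equiv.apply_symm_apply]

theorem IsSymmetric.cellMoment_self_eq {K : ℕ} {ν : Measure (Euc K)} (h : IsSymmetric ν)
    {I J : Finset (Fin K)} (hIJ : #I = #J) {i j : Fin K} (hij : i ∈ I ↔ j ∈ J) :
    cellMoment ν I i i = cellMoment ν J j j := by
  obtain ⟨p, rfl, rfl⟩ := exists_perm_map_eq hIJ hij
  exact (h.cellMoment_map p I i i).symm

theorem integrable_mul_of_sphere {K : ℕ} {ν : Measure (Euc K)} [IsProbabilityMeasure ν]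
    (hsphere : ∀ᵐ x ∂ν, ‖x‖ = 1) (i j : Fin K) : Integrable (fun x : Euc K => x i * x j) ν := by
  refine Integrable.of_bound (by fun_prop) 1 ?_
  filter_upwards [hsphere] with x hx
  have h1 : ∀ k, |x k| ≤ 1 := fun k => by
    have := PiLp.norm_apply_le x k
    rwa [hx] at this
  rw [Real.norm_eq_abs, abs_mul]
  exact mul_le_one₀ (h1 i) (abs_nonneg _) (h1 j)

theorem norm_map_synth_sq {d K : ℕ} (Φ : Dict d K) (T : Euc d →ₗ[ℝ] Euc d) (x : Euc K) :
    ‖T (synth Φ x)‖ ^ 2 = ∑ i, ∑ j, x i * x j * inner ℝ (T (Φ i)) (T (Φ j)) := by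
  rw [← real_inner_self_eq_norm_sq, synth, map_sum, sum_inner]
  refine Finset.sum_congr rfl fun i _ => ?_
  rw [inner_sum]
  refine Finset.sum_congr rfl fun j _ => ?_
  rw [map_smul, map_smul, inner_smul_left, inner_smul_right]
  simp
  ring

theorem integrable_norm_map_synth_sq {d K : ℕ} (Φ : Dict d K) {ν : Measure (Euc K)}
    [IsProbabilityMeasure ν] (hsphere : ∀ᵐ x ∂ν, ‖x‖ = 1) (T : Euc d →ₗ[ℝ] Euc d) :
    Integrable (fun x => ‖T (synth Φ x)‖ ^ 2) ν := by
  simp_rw [norm_map_synth_sq]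
  exact integrable_finsetSum _ fun i _ => integrable_finsetSum _ fun j _ =>
    (integrable_mul_of_sphere hsphere i j).mul_const _

theorem IsSymmetric.setIntegral_norm_map_synth_sq {d K : ℕ} (Φ : Dict d K) {ν : Measure (Euc K)}
    [IsProbabilityMeasure ν] (hsphere : ∀ᵐ x ∂ν, ‖x‖ = 1) (h : IsSymmetric ν)
    (I : Finset (Fin K)) (T : Euc d →ₗ[ℝ] Euc d) :
    ∫ x in cell I, ‖T (synth Φ x)‖ ^ 2 ∂ν = ∑ k, cellMoment ν I k k * ‖T (Φ k)‖ ^ 2 := by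
  have hint := fun i j => (integrable_mul_of_sphere hsphere i j).integrableOn (s := cell I)
  simp_rw [norm_map_synth_sq]
  rw [integral_finsetSum _ fun i _ => integrable_finsetSum _ fun j _ => (hint i j).mul_const _]
  refine Finset.sum_congr rfl fun i _ => ?_
  rw [integral_finsetSum _ fun j _ => (hint i j).mul_const _, Finset.sum_eq_single i]
  · rw [integral_mul_const, real_inner_self_eq_norm_sq, cellMoment]
  · intro j _ hj
    rw [integral_mul_const, ← cellMoment, h.cellMoment_eq_zero I hj.symm, zero_mul]
  · simp

/-! ### The cells cover the sphere, and carry the margin -/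

/-- The margin inequality for the vectors `c_{p,σ}(x)` makes `x` lie in the cell of its `S` largest
coefficients. A tie between positions `S` and `S + 1` would give two distinct optimal index sets. -/
theorem exists_mem_cell_of_margin {d K S : ℕ} (hSK : S < K) (Φ : Dict d K) {κ : ℝ} (hκ : 0 < κ)
    (x : Euc K)
    (hx : ∀ (p : Equiv.Perm (Fin K)) (σ : Fin K → ℤˣ) (I : Finset (Fin K)),
      #I ≤ S → I ≠ topSet S p →
        2 * κ ≤ ‖proj Φ (topSet S p) (synth Φ (signPerm (rearr x) p σ))‖
          - ‖proj Φ I (synth Φ (signPerm (rearr x) p σ))‖) :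
    ∃ I : Finset (Fin K), #I = S ∧ x ∈ cell I ∧
      (∀ J : Finset (Fin K), #J ≤ S → J ≠ I →
        2 * κ ≤ ‖proj Φ I (synth Φ x)‖ - ‖proj Φ J (synth Φ x)‖) ∧
      ∑ i ∈ univ.filter (fun i : Fin K => (i : ℕ) < S), rearr x i ^ 2 = ∑ i ∈ I, x i ^ 2 := by
  classical
  set τ := Tuple.sort (fun j => -|x j|) with hτ
  have hr : ∀ i, rearr x i = |x (τ i)| := fun i => rfl
  have hcard : ∀ p : Equiv.Perm (Fin K), #(topSet S p) = S := by
    intro p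
    have : topSet S p = (univ.filter fun i : Fin K => (i : ℕ) < S).map p.symm.toEmbedding := by
      ext i; simp [topSet, Finset.mem_map_equiv]
    rw [this, Finset.card_map]
    have h2 := Fin.card_filter_val_lt (n := K) (m := S)
    simpa [hSK.le] using h2
  obtain ⟨σ, hσ⟩ : ∃ σ : Fin K → ℤˣ, ∀ i, ((σ i : ℤ) : ℝ) * |x i| = x i := by
    refine ⟨fun i => if 0 ≤ x i then 1 else -1, fun i => ?_⟩
    by_cases h : 0 ≤ x i
    · simp [h, abs_of_nonneg h]
    · simp [h, abs_of_neg (not_le.1 h)]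
  have hsp : ∀ p : Equiv.Perm (Fin K), (∀ i, |x (τ (p i))| = |x i|) →
      signPerm (rearr x) p σ = x := by
    intro p hp
    ext i
    simp only [signPerm, hr, hp, hσ]
  have h₀ : ∀ i, |x (τ (τ.symm i))| = |x i| := by simp
  set I := topSet S τ.symm with hI
  have hmI : ∀ i, i ∈ I ↔ (τ.symm i : ℕ) < S := fun i => by simp [hI, topSet]
  have hmarg : ∀ J : Finset (Fin K), #J ≤ S → J ≠ I →
        2 * κ ≤ ‖proj Φ I (synth Φ x)‖ - ‖proj Φ J (synth Φ x)‖ := by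
    intro J hJ hJI
    have := hx τ.symm σ J hJ hJI
    rwa [hsp _ h₀] at this
  refine ⟨I, hcard _, ?_, hmarg, ?_⟩
  · intro i hi j hj
    have h1 : τ.symm i ≤ τ.symm j := by
      have h2 := (hmI i).1 hi
      have h3 := mt (hmI j).2 hj
      rw [Fin.le_def]; omega
    have h2 : |x j| ≤ |x i| := by
      have := rearr_antitone x h1
      simpa [hr] using this
    refine lt_of_le_of_ne h2 fun heq => ?_
    let p := (Equiv.swap i j).trans τ.symm
    have hp : ∀ k, |x (τ (p k))| = |x k| := by
      intro k
      simp only [p, Equiv.trans_apply, Equiv.apply_symm_apply]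
      rcases eq_or_ne k i with rfl | hki
      · simp [heq]
      · rcases eq_or_ne k j with rfl | hkj
        · simp [heq]
        · rw [Equiv.swap_apply_of_ne_of_ne hki hkj]
    have hne : topSet S p ≠ I := by
      intro h
      have : j ∈ topSet S p :=
        Finset.mem_filter.2 ⟨Finset.mem_univ _, by simpa [p] using (hmI i).1 hi⟩
      rw [h] at this
      exact hj this
    have h3 := hx p σ I (hcard _).le hne.symm
    rw [hsp _ hp] at h3
    have h4 := hmarg (topSet S p) (hcard _).le hne
    linarith
  · have : I = (univ.filter fun i : Fin K => (i : ℕ) < S).map τ.toEmbedding := by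
      ext i; simp [hmI, Finset.mem_map_equiv]
    rw [this, Finset.sum_map]
    simp [hr]


/-! ### The two values of the second moments -/

theorem sum_indicator_cell {K S : ℕ} {I : Finset (Fin K)} (hI : #I = S) {x : Euc K}
    (hx : x ∈ cell I) (f : Finset (Fin K) → Euc K → ℝ) :
    ∑ J ∈ powersetCard S univ, (cell J).indicator (f J) x = f I x := by
  rw [Finset.sum_eq_single I]
  · rw [Set.indicator_of_mem hx]
  · intro J hJ hJI
    refine Set.indicator_of_notMem (fun hxJ => hJI ?_) _
    exact eq_of_mem_cell ((Finset.mem_powersetCard_univ.1 hJ).trans hI.symm) hxJ hx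
  · intro h
    exact absurd (Finset.mem_powersetCard_univ.2 hI) h

theorem sum_setIntegral_cell {K S : ℕ} {ν : Measure (Euc K)} {f : Finset (Fin K) → Euc K → ℝ}
    {g : Euc K → ℝ} (hf : ∀ I, Integrable (f I) ν)
    (hcov : ∀ᵐ x ∂ν, ∃ I : Finset (Fin K), #I = S ∧ x ∈ cell I ∧ f I x = g x) :
    ∑ I ∈ powersetCard S univ, ∫ x in cell I, f I x ∂ν = ∫ x, g x ∂ν := by
  simp_rw [← integral_indicator (measurableSet_cell _)]
  rw [← integral_finsetSum _ fun I _ => (hf I).indicator (measurableSet_cell I)]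
  refine integral_congr_ae ?_
  filter_upwards [hcov] with x ⟨I, hI, hx, hfg⟩
  rw [sum_indicator_cell hI hx, hfg]

/-- The mean square of a coefficient outside the `S` largest ones, for a law on the sphere; the one
of a coefficient among the `S` largest is `gammaSq ν S / S`, and `lambdaS` is the difference. -/
noncomputable def tailMoment {K : ℕ} (ν : Measure (Euc K)) (S : ℕ) : ℝ :=
  (1 - gammaSq ν S) / ((K : ℝ) - (S : ℝ))

theorem HasMargin.ae_exists_cell {d K S : ℕ} {Φ : Dict d K} {κ : ℝ} {ν : Measure (Euc K)}
    (hSK : S < K) (hκ : 0 < κ) (hmargin : HasMargin Φ S ν κ) :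
    ∀ᵐ x ∂ν, ∃ I : Finset (Fin K), #I = S ∧ x ∈ cell I ∧
      (∀ J : Finset (Fin K), #J ≤ S → J ≠ I →
        2 * κ ≤ ‖proj Φ I (synth Φ x)‖ - ‖proj Φ J (synth Φ x)‖) ∧
      ∑ i ∈ univ.filter (fun i : Fin K => (i : ℕ) < S), rearr x i ^ 2 = ∑ i ∈ I, x i ^ 2 := by
  filter_upwards [hmargin] with x hx
  exact exists_mem_cell_of_margin hSK Φ hκ x hx

section

variable {d K S : ℕ} {Φ : Dict d K} {A κ : ℝ} {ν : Measure (Euc K)} [IsProbabilityMeasure ν]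

theorem sum_sum_cellMoment (hSK : S < K) (hκ : 0 < κ) (hmargin : HasMargin Φ S ν κ)
    (hsphere : ∀ᵐ x ∂ν, ‖x‖ = 1) :
    ∑ I ∈ powersetCard S univ, ∑ k, cellMoment ν I k k = 1 := by
  have h := sum_setIntegral_cell (S := S) (ν := ν) (f := fun _ x => ∑ k, x k * x k)
    (g := fun _ => 1) (fun _ => integrable_finsetSum _ fun k _ =>
      integrable_mul_of_sphere hsphere k k) (by
        filter_upwards [hmargin.ae_exists_cell hSK hκ, hsphere] with x ⟨I, hI, hx, _, _⟩ hx1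
        refine ⟨I, hI, hx, ?_⟩
        have := EuclideanSpace.real_norm_sq_eq x
        rw [hx1] at this
        simp only [← sq]
        rw [← this, one_pow])
  rw [integral_const, probReal_univ, one_smul] at h
  rw [← h]
  refine Finset.sum_congr rfl fun I _ => ?_
  rw [integral_finsetSum _ fun k _ => (integrable_mul_of_sphere hsphere k k).integrableOn]
  rfl

theorem sum_sum_mem_cellMoment (hSK : S < K) (hκ : 0 < κ) (hmargin : HasMargin Φ S ν κ)
    (hsphere : ∀ᵐ x ∂ν, ‖x‖ = 1) :
    ∑ I ∈ powersetCard S univ, ∑ k ∈ I, cellMoment ν I k k = gammaSq ν S := by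
  have h := sum_setIntegral_cell (S := S) (ν := ν) (f := fun I x => ∑ k ∈ I, x k * x k)
    (g := fun x => ∑ i ∈ univ.filter (fun i : Fin K => (i : ℕ) < S), rearr x i ^ 2)
    (fun _ => integrable_finsetSum _ fun k _ => integrable_mul_of_sphere hsphere k k) (by
        filter_upwards [hmargin.ae_exists_cell hSK hκ] with x ⟨I, hI, hx, _, hs⟩
        refine ⟨I, hI, hx, ?_⟩
        rw [hs]
        simp only [sq])
  rw [gammaSq, ← h]
  refine Finset.sum_congr rfl fun I _ => ?_
  rw [integral_finsetSum _ fun k _ => (integrable_mul_of_sphere hsphere k k).integrableOn]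
  rfl

theorem gammaSq_mem (hSK : S < K) (hκ : 0 < κ) (hmargin : HasMargin Φ S ν κ)
    (hsphere : ∀ᵐ x ∂ν, ‖x‖ = 1) : 0 ≤ gammaSq ν S ∧ gammaSq ν S ≤ 1 := by
  rw [← sum_sum_mem_cellMoment hSK hκ hmargin hsphere]
  refine ⟨Finset.sum_nonneg fun I _ => Finset.sum_nonneg fun k _ =>
    cellMoment_self_nonneg ν I k, ?_⟩
  rw [← sum_sum_cellMoment hSK hκ hmargin hsphere]
  refine Finset.sum_le_sum fun I _ => ?_
  exact Finset.sum_le_sum_of_subset_of_nonneg (Finset.subset_univ I) fun k _ _ =>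
    cellMoment_self_nonneg ν I k

/-- By symmetry, the second moments on the cell of `I` take only two values. -/
theorem cellMoment_self_eq_ite (hS : 1 ≤ S) (hSK : S < K) (hκ : 0 < κ)
    (hmargin : HasMargin Φ S ν κ) (hsphere : ∀ᵐ x ∂ν, ‖x‖ = 1) (hsymm : IsSymmetric ν)
    {I : Finset (Fin K)} (hI : #I = S) (k : Fin K) :
    cellMoment ν I k k =
      (if k ∈ I then gammaSq ν S / S else tailMoment ν S) / (K.choose S : ℝ) := by
  have hC : (0 : ℝ) < (K.choose S : ℝ) := by exact_mod_cast Nat.choose_pos hSK.le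
  have hS0 : (0 : ℝ) < S := by exact_mod_cast hS
  have hKS : (0 : ℝ) < (K : ℝ) - S := by
    have : (S : ℝ) < K := by exact_mod_cast hSK
    linarith
  have hin : ∀ k ∈ I, (K.choose S : ℝ) * (S * cellMoment ν I k k) = gammaSq ν S := by
    intro k hk
    rw [← sum_sum_mem_cellMoment hSK hκ hmargin hsphere]
    have : ∀ J ∈ powersetCard S (univ : Finset (Fin K)),
        ∑ i ∈ J, cellMoment ν J i i = S * cellMoment ν I k k := by
      intro J hJ
      rw [Finset.mem_powersetCard_univ] at hJ
      rw [Finset.sum_congr rfl fun i hi => hsymm.cellMoment_self_eq (hJ.trans hI.symm)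
        (by simp [hi, hk] : i ∈ J ↔ k ∈ I), Finset.sum_const, hJ, nsmul_eq_mul]
    rw [Finset.sum_congr rfl this, Finset.sum_const, Finset.card_powersetCard, Finset.card_univ,
      Fintype.card_fin, nsmul_eq_mul]
  have hout : ∀ k ∉ I, (K.choose S : ℝ) * (((K : ℝ) - S) * cellMoment ν I k k) =
      1 - gammaSq ν S := by
    intro k hk
    rw [← sum_sum_mem_cellMoment hSK hκ hmargin hsphere,
      ← sum_sum_cellMoment hSK hκ hmargin hsphere, ← Finset.sum_sub_distrib]
    have : ∀ J ∈ powersetCard S (univ : Finset (Fin K)),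
        ∑ i, cellMoment ν J i i - ∑ i ∈ J, cellMoment ν J i i =
          ((K : ℝ) - S) * cellMoment ν I k k := by
      intro J hJ
      rw [Finset.mem_powersetCard_univ] at hJ
      rw [← Finset.sum_add_sum_compl J, add_sub_cancel_left,
        Finset.sum_congr rfl fun i hi => hsymm.cellMoment_self_eq (hJ.trans hI.symm)
        (by simp only [Finset.mem_compl] at hi; simp [hi, hk] : i ∈ J ↔ k ∈ I),
        Finset.sum_const, Finset.card_compl, hJ, nsmul_eq_mul, Fintype.card_fin,
        Nat.cast_sub hSK.le]
    rw [Finset.sum_congr rfl this, Finset.sum_const, Finset.card_powersetCard, Finset.card_univ,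
      Fintype.card_fin, nsmul_eq_mul]
  split_ifs with hk
  · rw [← hin k hk]; field_simp
  · rw [tailMoment, ← hout k hk]; field_simp

theorem lambdaS_eq (ν : Measure (Euc K)) (S : ℕ) :
    lambdaS ν S = gammaSq ν S / S - tailMoment ν S := rfl

theorem moment_sum_eq_one (hS : 1 ≤ S) (hSK : S < K) (ν : Measure (Euc K)) :
    (S : ℝ) * (gammaSq ν S / S) + ((K : ℝ) - S) * tailMoment ν S = 1 := by
  have hS0 : (S : ℝ) ≠ 0 := by positivity
  have hKS : (K : ℝ) - S ≠ 0 := by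
    have : (S : ℝ) < K := by exact_mod_cast hSK
    linarith
  rw [tailMoment]
  field_simp
  ring

theorem sum_cellMoment_mul (hS : 1 ≤ S) (hSK : S < K) (hκ : 0 < κ)
    (hmargin : HasMargin Φ S ν κ) (hsphere : ∀ᵐ x ∂ν, ‖x‖ = 1) (hsymm : IsSymmetric ν)
    {I : Finset (Fin K)} (hI : #I = S) (f : Fin K → ℝ) :
    ∑ k, cellMoment ν I k k * f k =
      (lambdaS ν S * ∑ k ∈ I, f k + tailMoment ν S * ∑ k, f k) / (K.choose S : ℝ) := by
  classical
  simp_rw [cellMoment_self_eq_ite hS hSK hκ hmargin hsphere hsymm hI]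
  have : ∀ k, (if k ∈ I then gammaSq ν S / S else tailMoment ν S) / (K.choose S : ℝ) * f k =
      (lambdaS ν S * (if k ∈ I then f k else 0) + tailMoment ν S * f k) / (K.choose S : ℝ) := by
    intro k
    split_ifs
    · rw [lambdaS_eq]; ring
    · ring
  simp_rw [this]
  rw [← Finset.sum_div, Finset.sum_add_distrib, ← Finset.mul_sum, ← Finset.mul_sum]
  simp

theorem measureReal_cell (hS : 1 ≤ S) (hSK : S < K) (hκ : 0 < κ)
    (hmargin : HasMargin Φ S ν κ) (hsphere : ∀ᵐ x ∂ν, ‖x‖ = 1) (hsymm : IsSymmetric ν)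
    {I : Finset (Fin K)} (hI : #I = S) : ν.real (cell I) = 1 / (K.choose S : ℝ) := by
  have h1 : ∑ k, cellMoment ν I k k = ν.real (cell I) := by
    have : ∫ x in cell I, ∑ k, x k * x k ∂ν = ∫ x in cell I, (1 : ℝ) ∂ν := by
      refine integral_congr_ae (ae_restrict_of_ae ?_)
      filter_upwards [hsphere] with x hx1
      have := EuclideanSpace.real_norm_sq_eq x
      rw [hx1] at this
      simp only [← sq]
      rw [← this, one_pow]
    rw [integral_finsetSum _ fun k _ => (integrable_mul_of_sphere hsphere k k).integrableOn]
      at this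
    simpa [cellMoment] using this
  have h2 := sum_cellMoment_mul hS hSK hκ hmargin hsphere hsymm hI fun _ => 1
  simp only [mul_one] at h2
  rw [← h1, h2]
  simp only [Finset.sum_const, hI, Finset.card_univ, Fintype.card_fin, nsmul_eq_mul, mul_one]
  congr 1
  rw [← moment_sum_eq_one hS hSK ν, lambdaS_eq]
  ring

/-- The mean gap, on the cell of `I`, between the projections of the signals onto the span of the
generating atoms and onto another span of atoms. -/
theorem setIntegral_gap (hS : 1 ≤ S) (hSK : S < K)
    (hframe : IsTightFrame Φ A) (hκ : 0 < κ)
    (hmargin : HasMargin Φ S ν κ) (hsphere : ∀ᵐ x ∂ν, ‖x‖ = 1) (hsymm : IsSymmetric ν)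
    {I : Finset (Fin K)} (hI : #I = S) (Ψ : Dict d K) (J : Finset (Fin K)) :
    ∫ x in cell I, (‖proj Φ I (synth Φ x)‖ ^ 2 - ‖proj Ψ J (synth Φ x)‖ ^ 2) ∂ν =
      (lambdaS ν S * ∑ k ∈ I, ‖Φ k - proj Ψ J (Φ k)‖ ^ 2 + tailMoment ν S * (A *
        (Module.finrank ℝ (atomSpan Φ I) - Module.finrank ℝ (atomSpan Ψ J)))) /
        (K.choose S : ℝ) := by
  have h1 := hsymm.setIntegral_norm_map_synth_sq Φ hsphere I (projL Φ I)
  have h2 := hsymm.setIntegral_norm_map_synth_sq Φ hsphere I (projL Ψ J)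
  have i1 := (integrable_norm_map_synth_sq Φ hsphere (projL Φ I)).integrableOn (s := cell I)
  have i2 := (integrable_norm_map_synth_sq Φ hsphere (projL Ψ J)).integrableOn (s := cell I)
  simp only [projL_apply] at h1 h2 i1 i2
  rw [integral_sub i1 i2, h1, h2, ← Finset.sum_sub_distrib]
  simp_rw [← mul_sub]
  rw [sum_cellMoment_mul hS hSK hκ hmargin hsphere hsymm hI]
  have h3 : ∑ k ∈ I, (‖proj Φ I (Φ k)‖ ^ 2 - ‖proj Ψ J (Φ k)‖ ^ 2) =
      ∑ k ∈ I, ‖Φ k - proj Ψ J (Φ k)‖ ^ 2 := by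
    refine Finset.sum_congr rfl fun k hk => ?_
    rw [proj_of_mem Φ I (atom_mem_span Φ hk), norm_sq_eq_proj Ψ J (Φ k)]
    ring
  rw [h3, Finset.sum_sub_distrib, hframe.sum_norm_proj_sq, hframe.sum_norm_proj_sq, mul_sub A]

/-! ### What the margin says about the frame -/

theorem tailMoment_nonneg (hSK : S < K) (hκ : 0 < κ) (hmargin : HasMargin Φ S ν κ)
    (hsphere : ∀ᵐ x ∂ν, ‖x‖ = 1) : 0 ≤ tailMoment ν S := by
  have hKS : (S : ℝ) < K := by exact_mod_cast hSK
  exact div_nonneg (by linarith [(gammaSq_mem hSK hκ hmargin hsphere).2]) (by linarith)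

/-- The margin, integrated over a cell: exchanging one atom of an index set loses a definite
amount. -/
theorem le_gap_of_margin (hS : 1 ≤ S) (hSK : S < K)
    (hframe : IsTightFrame Φ A) (hκ : 0 < κ)
    (hmargin : HasMargin Φ S ν κ) (hsphere : ∀ᵐ x ∂ν, ‖x‖ = 1) (hsymm : IsSymmetric ν)
    {J : Finset (Fin K)} (hJ : #J = S) {i j : Fin K} (hi : i ∉ J) (hj : j ∈ J) :
    4 * κ ^ 2 ≤ lambdaS ν S * ‖Φ i - proj Φ J (Φ i)‖ ^ 2 + tailMoment ν S * (A *
        (Module.finrank ℝ (atomSpan Φ (insert i (J.erase j))) -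
          Module.finrank ℝ (atomSpan Φ J))) := by
  classical
  set I := insert i (J.erase j) with hIdef
  have hiJ : i ∉ J.erase j := fun h => hi (Finset.mem_of_mem_erase h)
  have hI : #I = S := by
    rw [hIdef, Finset.card_insert_of_notMem hiJ, Finset.card_erase_of_mem hj, hJ]; omega
  have hJI : J ≠ I := fun h => hi (h ▸ Finset.mem_insert_self i _)
  have hC : (0 : ℝ) < (K.choose S : ℝ) := by exact_mod_cast Nat.choose_pos hSK.le
  have h1 := setIntegral_gap hS hSK hframe hκ hmargin hsphere hsymm hI Φ J
  have hsum : ∑ k ∈ I, ‖Φ k - proj Φ J (Φ k)‖ ^ 2 = ‖Φ i - proj Φ J (Φ i)‖ ^ 2 := by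
    rw [hIdef, Finset.sum_insert hiJ, Finset.sum_eq_zero, add_zero]
    intro k hk
    rw [proj_of_mem Φ J (atom_mem_span Φ (Finset.mem_of_mem_erase hk))]
    simp
  rw [hsum] at h1
  have h2 : ∫ x in cell I, 4 * κ ^ 2 ∂ν ≤
      ∫ x in cell I, (‖proj Φ I (synth Φ x)‖ ^ 2 - ‖proj Φ J (synth Φ x)‖ ^ 2) ∂ν := by
    refine setIntegral_mono_on_ae (integrable_const _).integrableOn ?_ (measurableSet_cell I) ?_
    · exact ((integrable_norm_map_synth_sq Φ hsphere (projL Φ I)).sub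
        (integrable_norm_map_synth_sq Φ hsphere (projL Φ J))).integrableOn
    · filter_upwards [hmargin.ae_exists_cell hSK hκ] with x ⟨I', hI', hx', hm, _⟩ hx
      obtain rfl := eq_of_mem_cell (hI'.trans hI.symm) hx' hx
      have := hm J hJ.le hJI
      nlinarith [norm_nonneg (proj Φ J (synth Φ x))]
  rw [h1, setIntegral_const, measureReal_cell hS hSK hκ hmargin hsphere hsymm hI, smul_eq_mul,
    one_div, inv_mul_eq_div] at h2
  exact (div_le_div_iff_of_pos_right hC).1 h2

/-- All sets of `S` atoms are linearly independent: compare a set spanning a space of minimal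
dimension with the sets obtained by exchanging one atom. -/
theorem finrank_atomSpan_eq_of_margin (hS : 1 ≤ S) (hSK : S < K)
    (hframe : IsTightFrame Φ A) (hκ : 0 < κ)
    (hmargin : HasMargin Φ S ν κ) (hsphere : ∀ᵐ x ∂ν, ‖x‖ = 1) (hsymm : IsSymmetric ν)
    {J : Finset (Fin K)} (hJ : #J = S) : Module.finrank ℝ (atomSpan Φ J) = S := by
  classical
  have hle : ∀ I : Finset (Fin K), #I = S → Module.finrank ℝ (atomSpan Φ I) ≤ S := by
    intro I hI
    rw [← hI, atomSpan, ← Finset.coe_image]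
    exact (finrank_span_finset_le_card _).trans Finset.card_image_le
  obtain ⟨I, hI, hmin⟩ := Finset.exists_min_image (powersetCard S (univ : Finset (Fin K)))
    (fun I => Module.finrank ℝ (atomSpan Φ I))
    (Finset.powersetCard_nonempty.2 (by simpa using hSK.le))
  rw [Finset.mem_powersetCard_univ] at hI
  obtain ⟨j, hj⟩ : ∃ j, j ∉ I := by
    by_contra! h
    have : I = univ := Finset.eq_univ_of_forall h
    rw [this] at hI
    simp at hI
    omega
  have hind : LinearIndepOn ℝ Φ (I : Set (Fin K)) := by
    rw [linearIndepOn_iff_notMem_span]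
    intro i hi hmem
    have hi' : i ∈ I := by exact_mod_cast hi
    have hjI : j ∉ I.erase i := fun h => hj (Finset.mem_of_mem_erase h)
    set J' := insert j (I.erase i) with hJ'
    have hJ'c : #J' = S := by
      rw [hJ', Finset.card_insert_of_notMem hjI, Finset.card_erase_of_mem hi', hI]; omega
    have hiJ' : i ∉ J' := by
      rw [hJ', Finset.mem_insert]
      rintro (rfl | h)
      · exact hj hi'
      · simp at h
    have hback : insert i (J'.erase j) = I := by
      rw [hJ', Finset.erase_insert hjI, Finset.insert_erase hi']
    have h := le_gap_of_margin hS hSK hframe hκ hmargin hsphere hsymm hJ'c hiJ'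
      (Finset.mem_insert_self j _)
    rw [hback] at h
    have h2 : Φ i ∈ atomSpan Φ J' := by
      refine Submodule.span_mono ?_ hmem
      refine Set.image_mono fun k hk => ?_
      simp only [Set.mem_sdiff, Set.mem_singleton_iff, Finset.mem_coe] at hk
      simp [hJ', hk.1, hk.2]
    rw [proj_of_mem Φ J' h2, sub_self, norm_zero] at h
    have h3 : (Module.finrank ℝ (atomSpan Φ I) : ℝ) ≤ Module.finrank ℝ (atomSpan Φ J') := by
      exact_mod_cast hmin J' (Finset.mem_powersetCard_univ.2 hJ'c)
    have h4 := tailMoment_nonneg hSK hκ hmargin hsphere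
    have h5 : tailMoment ν S * (A * ((Module.finrank ℝ (atomSpan Φ I) : ℝ) -
        Module.finrank ℝ (atomSpan Φ J'))) ≤ 0 :=
      mul_nonpos_of_nonneg_of_nonpos h4
        (mul_nonpos_of_nonneg_of_nonpos hframe.1.le (by linarith))
    have h6 : 0 < κ ^ 2 := by positivity
    nlinarith
  have hrank : Module.finrank ℝ (atomSpan Φ I) = S := by
    have := finrank_span_set_eq_card (R := ℝ) (s := Φ '' (I : Set (Fin K))) hind.id_image
    rw [atomSpan, this, Set.toFinset_card, ← Nat.card_eq_fintype_card,
      Nat.card_image_of_injOn hind.injOn]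
    simpa using hI
  have h1 := hmin J (Finset.mem_powersetCard_univ.2 hJ)
  simp only [hrank] at h1
  exact le_antisymm (hle J hJ) h1

theorem le_lambdaS_mul_of_margin (hS : 1 ≤ S) (hSK : S < K)
    (hframe : IsTightFrame Φ A) (hκ : 0 < κ)
    (hmargin : HasMargin Φ S ν κ) (hsphere : ∀ᵐ x ∂ν, ‖x‖ = 1) (hsymm : IsSymmetric ν)
    {J : Finset (Fin K)} (hJ : #J = S) {i : Fin K} (hi : i ∉ J) :
    4 * κ ^ 2 ≤ lambdaS ν S * ‖Φ i - proj Φ J (Φ i)‖ ^ 2 := by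
  classical
  obtain ⟨j, hj⟩ : J.Nonempty := Finset.card_pos.1 (by omega)
  have h := le_gap_of_margin hS hSK hframe hκ hmargin hsphere hsymm hJ hi hj
  have hiJ : i ∉ J.erase j := fun h => hi (Finset.mem_of_mem_erase h)
  have hI : #(insert i (J.erase j)) = S := by
    rw [Finset.card_insert_of_notMem hiJ, Finset.card_erase_of_mem hj, hJ]; omega
  rw [finrank_atomSpan_eq_of_margin hS hSK hframe hκ hmargin hsphere hsymm hJ,
    finrank_atomSpan_eq_of_margin hS hSK hframe hκ hmargin hsphere hsymm hI] at h
  simpa using h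

theorem lambdaS_mul_le_one (hS : 1 ≤ S) (hSK : S < K) (hκ : 0 < κ)
    (hmargin : HasMargin Φ S ν κ) (hsphere : ∀ᵐ x ∂ν, ‖x‖ = 1) : lambdaS ν S * S ≤ 1 := by
  have h1 := tailMoment_nonneg hSK hκ hmargin hsphere
  have h2 := (gammaSq_mem hSK hκ hmargin hsphere).2
  have hS0 : (0 : ℝ) < S := by exact_mod_cast hS
  rw [lambdaS_eq, sub_mul, div_mul_cancel₀ _ hS0.ne']
  nlinarith

theorem four_mul_sq_le_lambdaS (hS : 1 ≤ S) (hSK : S < K) (hunit : Φ ∈ admissible d K)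
    (hframe : IsTightFrame Φ A) (hκ : 0 < κ)
    (hmargin : HasMargin Φ S ν κ) (hsphere : ∀ᵐ x ∂ν, ‖x‖ = 1) (hsymm : IsSymmetric ν) :
    4 * κ ^ 2 ≤ lambdaS ν S := by
  obtain ⟨J, -, hJ⟩ := Finset.exists_subset_card_eq
    (s := (univ : Finset (Fin K)).erase ⟨0, by omega⟩) (n := S) (by simp; omega)
  obtain ⟨i, hi⟩ : ∃ i, i ∉ J := by
    by_contra! h
    rw [Finset.eq_univ_of_forall h] at hJ
    simp at hJ
    omega
  have h := le_lambdaS_mul_of_margin hS hSK hframe hκ hmargin hsphere hsymm hJ hi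
  have h2 := norm_sub_proj_le Φ J (Φ i)
  rw [hunit i] at h2
  have h3 : ‖Φ i - proj Φ J (Φ i)‖ ^ 2 ≤ 1 := pow_le_one₀ (norm_nonneg _) h2
  have h4 : 0 < κ ^ 2 := by positivity
  have h5 : 0 < lambdaS ν S := by
    by_contra! hc
    nlinarith [sq_nonneg ‖Φ i - proj Φ J (Φ i)‖]
  nlinarith

/-- Any `S + 1` atoms are linearly independent, quantitatively. -/
theorem boundedBelow_of_margin (hS : 1 ≤ S) (hSK : S < K) (hunit : Φ ∈ admissible d K)
    (hframe : IsTightFrame Φ A) (hκ : 0 < κ)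
    (hmargin : HasMargin Φ S ν κ) (hsphere : ∀ᵐ x ∂ν, ‖x‖ = 1) (hsymm : IsSymmetric ν) :
    BoundedBelow Φ (S + 1) (√2 * κ) := by
  classical
  intro T hT a
  set v := ∑ k ∈ T, a k • Φ k with hv
  have h1 : ∀ j ∈ T, 4 * κ ^ 2 * a j ^ 2 ≤ lambdaS ν S * ‖v‖ ^ 2 := by
    intro j hj
    obtain ⟨J, hTJ, hJj, hJ⟩ := Finset.exists_subsuperset_card_eq (s := T.erase j)
      (t := univ.erase j) (n := S) (Finset.erase_subset_erase _ (Finset.subset_univ _))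
      (by rw [Finset.card_erase_of_mem hj]; omega)
      (by rw [Finset.card_erase_of_mem (Finset.mem_univ _)]; simp; omega)
    have hjJ : j ∉ J := fun h => by simpa using hJj h
    have h := le_lambdaS_mul_of_margin hS hSK hframe hκ hmargin hsphere hsymm hJ hjJ
    have hres : v - proj Φ J v = a j • (Φ j - proj Φ J (Φ j)) := by
      have h3 : v = a j • Φ j + ∑ k ∈ T.erase j, a k • Φ k := by
        rw [hv, Finset.add_sum_erase T (fun k => a k • Φ k) hj]
      have h4 : proj Φ J (a j • Φ j) = a j • proj Φ J (Φ j) := map_smul (projL Φ J) _ _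
      rw [h3, proj_add, h4,
        proj_of_mem Φ J (atomSpan_mono Φ hTJ (sum_smul_mem_span Φ (T.erase j) a)), smul_sub]
      abel
    have h5 := norm_sub_proj_le Φ J v
    rw [hres, norm_smul, Real.norm_eq_abs] at h5
    have h6 : a j ^ 2 * ‖Φ j - proj Φ J (Φ j)‖ ^ 2 ≤ ‖v‖ ^ 2 := by
      rw [← sq_abs (a j), ← mul_pow]
      exact pow_le_pow_left₀ (by positivity) h5 2
    have hl : 0 ≤ lambdaS ν S := le_trans (by positivity)
      (four_mul_sq_le_lambdaS hS hSK hunit hframe hκ hmargin hsphere hsymm)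
    calc 4 * κ ^ 2 * a j ^ 2 ≤ lambdaS ν S * ‖Φ j - proj Φ J (Φ j)‖ ^ 2 * a j ^ 2 := by gcongr
      _ = lambdaS ν S * (a j ^ 2 * ‖Φ j - proj Φ J (Φ j)‖ ^ 2) := by ring
      _ ≤ _ := by gcongr
  have h2 : 4 * κ ^ 2 * ∑ k ∈ T, a k ^ 2 ≤ #T * (lambdaS ν S * ‖v‖ ^ 2) := by
    rw [Finset.mul_sum, ← nsmul_eq_mul, ← Finset.sum_const]
    exact Finset.sum_le_sum h1
  have hl : 0 ≤ lambdaS ν S := le_trans (by positivity)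
    (four_mul_sq_le_lambdaS hS hSK hunit hframe hκ hmargin hsphere hsymm)
  have hlS := lambdaS_mul_le_one hS hSK hκ hmargin hsphere
  have hS1 : (1 : ℝ) ≤ S := by exact_mod_cast hS
  have hT' : (#T : ℝ) ≤ S + 1 := by exact_mod_cast hT
  have h3 : (#T : ℝ) * lambdaS ν S ≤ 2 := by
    calc (#T : ℝ) * lambdaS ν S ≤ (S + 1) * lambdaS ν S := by gcongr
      _ ≤ (S + S) * lambdaS ν S := by gcongr
      _ ≤ 2 := by linarith
  have h4 : (#T : ℝ) * (lambdaS ν S * ‖v‖ ^ 2) ≤ 2 * ‖v‖ ^ 2 := by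
    rw [← mul_assoc]; gcongr
  rw [mul_pow, Real.sq_sqrt (by norm_num)]
  linarith

end


/-! ### The loss of a perturbed dictionary on a single signal -/

/-- What a signal with coefficients `x` loses when the span of the atoms generating its largest
part is replaced by the span of the corresponding atoms of `Ψ`; zero outside the cells. -/
noncomputable def gap {d K : ℕ} (S : ℕ) (Φ Ψ : Dict d K) (x : Euc K) : ℝ :=
  ∑ I ∈ powersetCard S univ,
    (cell I).indicator (fun x => ‖proj Φ I (synth Φ x)‖ ^ 2 - ‖proj Ψ I (synth Φ x)‖ ^ 2) x

/-- The average over the index sets `I` of size `S` of the energy of the atoms `φ_i`, `i ∈ I`, that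
the span of the `ψ_i`, `i ∈ I`, misses. -/
noncomputable def drift {d K : ℕ} (S : ℕ) (Φ Ψ : Dict d K) : ℝ :=
  (∑ I ∈ powersetCard S univ, ∑ i ∈ I, ‖Φ i - proj Ψ I (Φ i)‖ ^ 2) / (K.choose S : ℝ)

theorem gap_eq {d K S : ℕ} (Φ Ψ : Dict d K) {I : Finset (Fin K)} (hI : #I = S) {x : Euc K}
    (hx : x ∈ cell I) :
    gap S Φ Ψ x = ‖proj Φ I (synth Φ x)‖ ^ 2 - ‖proj Ψ I (synth Φ x)‖ ^ 2 :=
  sum_indicator_cell hI hx _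

theorem continuous_synth {d K : ℕ} (Φ : Dict d K) : Continuous (synth Φ) := by
  unfold synth; fun_prop

theorem continuous_proj {d K : ℕ} (Φ : Dict d K) (I : Finset (Fin K)) : Continuous (proj Φ I) :=
  (atomSpan Φ I).starProjection.continuous

theorem measurable_gap {d K : ℕ} (S : ℕ) (Φ Ψ : Dict d K) : Measurable (gap S Φ Ψ) := by
  have h : ∀ (Θ : Dict d K) (I : Finset (Fin K)),
      Measurable fun x : Euc K => ‖proj Θ I (synth Φ x)‖ ^ 2 := fun Θ I =>
    (((continuous_proj Θ I).comp (continuous_synth Φ)).norm.pow 2).measurable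
  exact Finset.measurable_sum _ fun I _ =>
    ((h Φ I).sub (h Ψ I)).indicator (measurableSet_cell I)

section

variable {d K S : ℕ} {Φ : Dict d K} {A κ : ℝ} {ν : Measure (Euc K)} [IsProbabilityMeasure ν]

theorem integral_gap (hS : 1 ≤ S) (hSK : S < K)
    (hframe : IsTightFrame Φ A) (hκ : 0 < κ)
    (hmargin : HasMargin Φ S ν κ) (hsphere : ∀ᵐ x ∂ν, ‖x‖ = 1) (hsymm : IsSymmetric ν)
    {Ψ : Dict d K} (hΨ : BoundedBelow Ψ (S + 1) κ) :
    ∫ x, gap S Φ Ψ x ∂ν = lambdaS ν S * drift S Φ Ψ := by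
  have hcov : ∀ᵐ x ∂ν, ∃ I : Finset (Fin K), #I = S ∧ x ∈ cell I ∧
      ‖proj Φ I (synth Φ x)‖ ^ 2 - ‖proj Ψ I (synth Φ x)‖ ^ 2 = gap S Φ Ψ x := by
    filter_upwards [hmargin.ae_exists_cell hSK hκ] with x ⟨I, hI, hx, _, _⟩
    exact ⟨I, hI, hx, (gap_eq Φ Ψ hI hx).symm⟩
  rw [← sum_setIntegral_cell (fun I => (integrable_norm_map_synth_sq Φ hsphere (projL Φ I)).sub
    (integrable_norm_map_synth_sq Φ hsphere (projL Ψ I))) hcov, drift, ← mul_div_assoc,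
    Finset.mul_sum, Finset.sum_div]
  refine Finset.sum_congr rfl fun I hI => ?_
  rw [Finset.mem_powersetCard_univ] at hI
  refine (setIntegral_gap hS hSK hframe hκ hmargin hsphere hsymm hI Ψ I).trans ?_
  rw [finrank_atomSpan_eq_of_margin hS hSK hframe hκ hmargin hsphere hsymm hI,
    hΨ.finrank_atomSpan hκ (hI.le.trans (Nat.le_succ S)), hI]
  simp

theorem gap_abs_le (hframe : IsTightFrame Φ A) {I : Finset (Fin K)} (hI : #I = S) {x : Euc K}
    (hx : x ∈ cell I) (hx1 : ‖x‖ = 1) (Ψ : Dict d K) : |gap S Φ Ψ x| ≤ A := by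
  rw [gap_eq Φ Ψ hI hx]
  have h := hframe.norm_synth_sq_le x
  rw [hx1] at h
  have h1 := pow_le_pow_left₀ (norm_nonneg _) (norm_proj_le Φ I (synth Φ x)) 2
  have h2 := pow_le_pow_left₀ (norm_nonneg _) (norm_proj_le Ψ I (synth Φ x)) 2
  rw [abs_le]
  constructor <;> nlinarith [sq_nonneg ‖proj Φ I (synth Φ x)‖, sq_nonneg ‖proj Ψ I (synth Φ x)‖]

theorem sq_norm_sq_sub_norm_sq_le {E : Type*} [SeminormedAddCommGroup E] {u v : E} {R : ℝ}
    (hu : ‖u‖ ^ 2 ≤ R) (hv : ‖v‖ ^ 2 ≤ R) :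
    (‖u‖ ^ 2 - ‖v‖ ^ 2) ^ 2 ≤ 4 * R * ‖u - v‖ ^ 2 := by
  have h1 : (‖u‖ - ‖v‖) ^ 2 ≤ ‖u - v‖ ^ 2 := by
    rw [← sq_abs (‖u‖ - ‖v‖)]
    exact pow_le_pow_left₀ (abs_nonneg _) (abs_norm_sub_norm_le u v) 2
  have h2 : (‖u‖ + ‖v‖) ^ 2 ≤ 4 * R := by nlinarith [sq_nonneg (‖u‖ - ‖v‖)]
  calc (‖u‖ ^ 2 - ‖v‖ ^ 2) ^ 2 = (‖u‖ + ‖v‖) ^ 2 * (‖u‖ - ‖v‖) ^ 2 := by ring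
    _ ≤ 4 * R * ‖u - v‖ ^ 2 := by gcongr; exact (sq_nonneg _).trans h2

/-- The second moment of the loss is controlled by its mean: the energy that `P - P'` sees in all
the atoms is bounded by the energy it sees in the atoms of `I`. -/
theorem integral_gap_sq_le (hS : 1 ≤ S) (hSK : S < K) (hunit : Φ ∈ admissible d K)
    (hA : A = (K : ℝ) / (d : ℝ)) (hframe : IsTightFrame Φ A) (hκ : 0 < κ)
    (hmargin : HasMargin Φ S ν κ) (hsphere : ∀ᵐ x ∂ν, ‖x‖ = 1) (hsymm : IsSymmetric ν)
    {Ψ : Dict d K} (hΦ : BoundedBelow Φ (S + 1) κ) (hΨ : BoundedBelow Ψ (S + 1) κ) :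
    ∫ x, gap S Φ Ψ x ^ 2 ∂ν ≤ 12 * A / (S * κ ^ 2) * drift S Φ Ψ := by
  have hcov : ∀ᵐ x ∂ν, ∃ I : Finset (Fin K), #I = S ∧ x ∈ cell I ∧
      (‖proj Φ I (synth Φ x)‖ ^ 2 - ‖proj Ψ I (synth Φ x)‖ ^ 2) ^ 2 = gap S Φ Ψ x ^ 2 := by
    filter_upwards [hmargin.ae_exists_cell hSK hκ] with x ⟨I, hI, hx, _, _⟩
    exact ⟨I, hI, hx, by rw [gap_eq Φ Ψ hI hx]⟩
  have hS0 : (0 : ℝ) < S := by exact_mod_cast hS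
  have hA0 := hframe.1
  have hT : ∀ I, Integrable (fun x => ‖(projL Φ I - projL Ψ I) (synth Φ x)‖ ^ 2) ν :=
    fun I => integrable_norm_map_synth_sq Φ hsphere (projL Φ I - projL Ψ I)
  have hpt : ∀ I, ∀ᵐ x ∂ν,
      (‖proj Φ I (synth Φ x)‖ ^ 2 - ‖proj Ψ I (synth Φ x)‖ ^ 2) ^ 2 ≤
        4 * A * ‖(projL Φ I - projL Ψ I) (synth Φ x)‖ ^ 2 := by
    intro I
    filter_upwards [hsphere] with x hx1
    have h := hframe.norm_synth_sq_le x
    rw [hx1, one_pow, mul_one] at h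
    exact sq_norm_sq_sub_norm_sq_le
      ((pow_le_pow_left₀ (norm_nonneg _) (norm_proj_le Φ I (synth Φ x)) 2).trans h)
      ((pow_le_pow_left₀ (norm_nonneg _) (norm_proj_le Ψ I (synth Φ x)) 2).trans h)
  have hint : ∀ I, Integrable (fun x =>
      (‖proj Φ I (synth Φ x)‖ ^ 2 - ‖proj Ψ I (synth Φ x)‖ ^ 2) ^ 2) ν := by
    intro I
    refine ((hT I).const_mul (4 * A)).mono' ?_ ?_
    · have h : ∀ Θ : Dict d K, Continuous fun x : Euc K => ‖proj Θ I (synth Φ x)‖ ^ 2 :=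
        fun Θ => ((continuous_proj Θ I).comp (continuous_synth Φ)).norm.pow 2
      exact (((h Φ).sub (h Ψ)).pow 2).aestronglyMeasurable
    · filter_upwards [hpt I] with x hx
      rwa [Real.norm_eq_abs, abs_of_nonneg (sq_nonneg _)]
  rw [← sum_setIntegral_cell hint hcov]
  set β := tailMoment ν S with hβ
  set lam := lambdaS ν S with hlam
  have hβ0 : 0 ≤ β := tailMoment_nonneg hSK hκ hmargin hsphere
  have hlam4 : 4 * κ ^ 2 ≤ lam :=
    four_mul_sq_le_lambdaS hS hSK hunit hframe hκ hmargin hsphere hsymm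
  have hlam1 : lam * S ≤ 1 := lambdaS_mul_le_one hS hSK hκ hmargin hsphere
  have hS1 : (1 : ℝ) ≤ S := by exact_mod_cast hS
  have hκ0 : 0 < κ ^ 2 := by positivity
  have hκ1 : κ ^ 2 ≤ 1 := by nlinarith
  -- The tail moment is at most the average second moment `1 / K` of the coefficients.
  have hβK : β * K ≤ 1 := by
    have h := moment_sum_eq_one hS hSK ν
    have h' := lambdaS_eq ν S
    rw [← hβ, ← hlam] at h'
    rw [← hβ] at h
    nlinarith
  have hd : S ≤ d := by
    obtain ⟨J, -, hJ⟩ := Finset.exists_subset_card_eq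
      (s := (univ : Finset (Fin K))) (n := S) (by simp; omega)
    have h1 := finrank_atomSpan_eq_of_margin hS hSK hframe hκ hmargin hsphere hsymm hJ
    rw [← h1]
    simpa using Submodule.finrank_le (atomSpan Φ J)
  have hSd : (S : ℝ) ≤ d := by exact_mod_cast hd
  have hd0 : (0 : ℝ) < d := hS0.trans_le hSd
  have hβA : β * A * S ≤ 1 := by
    have : A * S ≤ K := by
      rw [hA, div_mul_eq_mul_div, div_le_iff₀ hd0]
      gcongr
    calc β * A * S = β * (A * S) := by ring
      _ ≤ β * K := by gcongr
      _ ≤ 1 := hβK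
  have hC : (0 : ℝ) < (K.choose S : ℝ) := by exact_mod_cast Nat.choose_pos hSK.le
  rw [drift, ← mul_div_assoc, Finset.mul_sum, Finset.sum_div]
  refine Finset.sum_le_sum fun I hI => ?_
  rw [Finset.mem_powersetCard_univ] at hI
  have hIS : #I ≤ S + 1 := hI.le.trans (Nat.le_succ S)
  set X := ∑ i ∈ I, ‖Φ i - proj Ψ I (Φ i)‖ ^ 2 with hX
  have hX0 : 0 ≤ X := by positivity
  have h1 : ∫ x in cell I, (‖proj Φ I (synth Φ x)‖ ^ 2 - ‖proj Ψ I (synth Φ x)‖ ^ 2) ^ 2 ∂ν ≤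
      4 * A * ∑ k, cellMoment ν I k k * ‖(projL Φ I - projL Ψ I) (Φ k)‖ ^ 2 := by
    rw [← hsymm.setIntegral_norm_map_synth_sq Φ hsphere I (projL Φ I - projL Ψ I),
      ← integral_const_mul]
    exact setIntegral_mono_ae (hint I).integrableOn ((hT I).const_mul _).integrableOn (hpt I)
  refine h1.trans ?_
  rw [sum_cellMoment_mul hS hSK hκ hmargin hsphere hsymm hI, mul_div_assoc', ← hlam, ← hβ]
  refine (div_le_div_iff_of_pos_right hC).2 ?_
  have h2 : ∑ k ∈ I, ‖(projL Φ I - projL Ψ I) (Φ k)‖ ^ 2 = X := by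
    refine Finset.sum_congr rfl fun k hk => ?_
    rw [LinearMap.sub_apply, projL_apply, projL_apply, proj_of_mem Φ I (atom_mem_span Φ hk)]
  have h3 : κ ^ 2 * ∑ k, ‖(projL Φ I - projL Ψ I) (Φ k)‖ ^ 2 ≤ 2 * A * X :=
    hframe.sum_norm_proj_sub_proj_sq_le hΦ hIS
      ((hΦ.finrank_atomSpan hκ hIS).trans (hΨ.finrank_atomSpan hκ hIS).symm)
  rw [h2]
  set V := ∑ k, ‖(projL Φ I - projL Ψ I) (Φ k)‖ ^ 2 with hV
  have h4 : S * κ ^ 2 * (lam * X + β * V) ≤ 3 * X := by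
    have e1 : S * κ ^ 2 * (lam * X) ≤ X := by
      calc S * κ ^ 2 * (lam * X) = (lam * S) * κ ^ 2 * X := by ring
        _ ≤ 1 * 1 * X := by gcongr
        _ = X := by ring
    have e2 : S * κ ^ 2 * (β * V) ≤ 2 * X := by
      calc S * κ ^ 2 * (β * V) = S * β * (κ ^ 2 * V) := by ring
        _ ≤ S * β * (2 * A * X) := by gcongr
        _ = 2 * (β * A * S) * X := by ring
        _ ≤ 2 * 1 * X := by gcongr
        _ = 2 * X := by ring
    linarith
  rw [div_mul_eq_mul_div, le_div_iff₀ (by positivity)]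
  calc 4 * A * (lam * X + β * V) * (S * κ ^ 2) = 4 * A * (S * κ ^ 2 * (lam * X + β * V)) := by
        ring
    _ ≤ 4 * A * (3 * X) := by gcongr
    _ = 12 * A * X := by ring

end

/-! ### A lower bound for the drift -/

/-- A vector orthogonal to one of `S + 1` quantitatively independent atoms cannot be close to all
the spans obtained by leaving out one of the other atoms. -/
theorem sum_norm_sub_proj_erase_sq_ge {d K S : ℕ} {Ψ : Dict d K} {κ : ℝ} (hS : 1 ≤ S)
    (hκ1 : κ ^ 2 ≤ 1) (hΨ : BoundedBelow Ψ (S + 1) κ) (hunit : Ψ ∈ admissible d K)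
    {T : Finset (Fin K)} (hT : #T = S + 1) {i : Fin K} (hi : i ∈ T) {w : Euc d}
    (hw : inner ℝ w (Ψ i) = 0) :
    κ ^ 2 / S * ‖w‖ ^ 2 ≤ ∑ j ∈ T.erase i, ‖w - proj Ψ (T.erase j) w‖ ^ 2 := by
  have hS1 : (1 : ℝ) ≤ S := by exact_mod_cast hS
  have hcard : #(T.erase i) = S := by rw [Finset.card_erase_of_mem hi, hT]; rfl
  obtain ⟨a, ha⟩ := exists_coeff (proj_mem Ψ T w)
  set u := proj Ψ T w with hu
  set ρ := ‖w - u‖ ^ 2 with hρ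
  set α := ∑ j ∈ T.erase i, a j ^ 2 with hα
  have hterm : ∀ j ∈ T, ρ + κ ^ 2 * a j ^ 2 ≤ ‖w - proj Ψ (T.erase j) w‖ ^ 2 := by
    intro j hj
    have hmem := proj_mem Ψ (T.erase j) w
    rw [norm_sub_sq_of_mem Ψ T (atomSpan_mono Ψ (Finset.erase_subset j T) hmem) w]
    obtain ⟨b, hb⟩ := exists_coeff hmem
    let c : Fin K → ℝ := fun k => a k - if k = j then 0 else b k
    have hc : ∑ k ∈ T, c k • Ψ k = u - proj Ψ (T.erase j) w := by
      rw [hb, ha]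
      simp only [c, sub_smul, Finset.sum_sub_distrib]
      congr 1
      rw [← Finset.add_sum_erase T _ hj]
      simp only [if_true, zero_smul, zero_add]
      refine Finset.sum_congr rfl fun k hk => ?_
      rw [if_neg (Finset.ne_of_mem_erase hk)]
    have h1 := hΨ T hT.le c
    rw [hc] at h1
    have h2 : a j ^ 2 ≤ ∑ k ∈ T, c k ^ 2 := by
      have := Finset.single_le_sum (f := fun k => c k ^ 2) (fun k _ => sq_nonneg _) hj
      simpa [c] using this
    have h3 : κ ^ 2 * a j ^ 2 ≤ κ ^ 2 * ∑ k ∈ T, c k ^ 2 := by gcongr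
    linarith
  have hsum : S * ρ + κ ^ 2 * α ≤ ∑ j ∈ T.erase i, ‖w - proj Ψ (T.erase j) w‖ ^ 2 := by
    calc S * ρ + κ ^ 2 * α = ∑ j ∈ T.erase i, (ρ + κ ^ 2 * a j ^ 2) := by
          rw [Finset.sum_add_distrib, Finset.sum_const, hcard, nsmul_eq_mul, ← Finset.mul_sum]
      _ ≤ _ := Finset.sum_le_sum fun j hj => hterm j (Finset.mem_of_mem_erase hj)
  -- As `w` is orthogonal to `Ψ i`, the norm of its projection `u` is carried by the other atoms.
  have hu1 : ‖u‖ ^ 2 ≤ S * α := by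
    set v := ∑ k ∈ T.erase i, a k • Ψ k with hv
    have huv : u = a i • Ψ i + v := by
      rw [ha, hv, Finset.add_sum_erase T (fun k => a k • Ψ k) hi]
    have h1 : ‖u‖ ^ 2 = inner ℝ u v := by
      have h0 : inner ℝ u (Ψ i) = 0 := by
        rw [hu, inner_proj_left, proj_of_mem Ψ T (atom_mem_span Ψ hi), hw]
      have h : inner ℝ u u = inner ℝ u (a i • Ψ i + v) := by rw [← huv]
      rw [← real_inner_self_eq_norm_sq, h, inner_add_right, inner_smul_right, h0, mul_zero,
        zero_add]
    have h2 : ‖u‖ ^ 2 ≤ ‖u‖ * ‖v‖ := h1 ▸ real_inner_le_norm u v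
    have h3 : ‖u‖ ≤ ‖v‖ := by
      rcases eq_or_lt_of_le (norm_nonneg u) with h0 | h0
      · rw [← h0]; positivity
      · nlinarith
    have h4 := norm_sum_smul_le (Θ := Ψ) zero_le_one (fun k => (hunit k).le) (T.erase i) a
    rw [hcard, ← hv, ← hα, one_mul] at h4
    calc ‖u‖ ^ 2 ≤ ‖v‖ ^ 2 := by gcongr
      _ ≤ (√(S : ℝ) * √α) ^ 2 := by gcongr
      _ = S * α := by rw [mul_pow, Real.sq_sqrt (by positivity), Real.sq_sqrt (by positivity)]
  have hw2 : ‖w‖ ^ 2 = ‖u‖ ^ 2 + ρ := norm_sq_eq_proj Ψ T w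
  refine le_trans ?_ hsum
  rw [hw2, div_mul_eq_mul_div, div_le_iff₀ (by positivity)]
  have hρ0 : 0 ≤ ρ := by positivity
  have hκ0 := sq_nonneg κ
  have e1 : κ ^ 2 * ‖u‖ ^ 2 ≤ κ ^ 2 * (S * α) := by gcongr
  have e2 : κ ^ 2 * ρ ≤ S * ρ * S := by
    calc κ ^ 2 * ρ ≤ 1 * ρ := by gcongr
      _ ≤ (S * S) * ρ := by gcongr; nlinarith
      _ = _ := by ring
  nlinarith

/-- Each set of size `S` containing `i` arises from `K - S` sets of size `S + 1` by leaving out an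
element other than `i`. -/
theorem sum_sum_insert_erase {K S : ℕ} (hS : 1 ≤ S) (hSK : S < K) (i : Fin K)
    (f : Finset (Fin K) → ℝ) :
    ∑ R ∈ powersetCard S (univ.erase i), ∑ j ∈ R, f (insert i (R.erase j)) =
      ((K : ℝ) - S) * ∑ I ∈ (powersetCard S univ).filter (i ∈ ·), f I := by
  classical
  have h1 : ((K : ℝ) - S) * ∑ I ∈ (powersetCard S univ).filter (i ∈ ·), f I =
      ∑ I ∈ (powersetCard S univ).filter (i ∈ ·), ∑ _j ∈ Iᶜ, f I := by
    rw [Finset.mul_sum]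
    refine Finset.sum_congr rfl fun I hI => ?_
    rw [Finset.mem_filter, Finset.mem_powersetCard_univ] at hI
    rw [Finset.sum_const, Finset.card_compl, hI.1, nsmul_eq_mul, Fintype.card_fin,
      Nat.cast_sub hSK.le]
  rw [h1, Finset.sum_sigma', Finset.sum_sigma']
  refine Finset.sum_bij' (fun p _ => ⟨insert i (p.1.erase p.2), p.2⟩)
    (fun p _ => ⟨insert p.2 (p.1.erase i), p.2⟩) ?_ ?_ ?_ ?_ ?_
  · rintro ⟨R, j⟩ h
    simp only [Finset.mem_sigma, Finset.mem_powersetCard, Finset.subset_erase] at h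
    obtain ⟨⟨⟨-, hi⟩, hR⟩, hj⟩ := h
    have hij : j ≠ i := fun e => hi (e ▸ hj)
    simp only [Finset.mem_sigma, Finset.mem_filter, Finset.mem_powersetCard_univ,
      Finset.mem_compl, Finset.mem_insert, true_or, and_true, hij, false_or]
    refine ⟨?_, by simp⟩
    rw [Finset.card_insert_of_notMem fun h => hi (Finset.mem_of_mem_erase h),
      Finset.card_erase_of_mem hj, hR]
    omega
  · rintro ⟨I, j⟩ h
    simp only [Finset.mem_sigma, Finset.mem_filter, Finset.mem_powersetCard_univ,
      Finset.mem_compl] at h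
    obtain ⟨⟨hI, hi⟩, hj⟩ := h
    have hij : i ≠ j := fun e => hj (e ▸ hi)
    simp only [Finset.mem_sigma, Finset.mem_powersetCard, Finset.subset_erase,
      Finset.mem_insert, true_or, and_true, hij, false_or]
    refine ⟨⟨Finset.subset_univ _, by simp⟩, ?_⟩
    rw [Finset.card_insert_of_notMem fun h => hj (Finset.mem_of_mem_erase h),
      Finset.card_erase_of_mem hi, hI]
    omega
  · rintro ⟨R, j⟩ h
    simp only [Finset.mem_sigma, Finset.mem_powersetCard, Finset.subset_erase] at h
    obtain ⟨⟨⟨-, hi⟩, hR⟩, hj⟩ := h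
    have : insert j ((insert i (R.erase j)).erase i) = R := by
      rw [Finset.erase_insert fun h => hi (Finset.mem_of_mem_erase h), Finset.insert_erase hj]
    simp only [this]
  · rintro ⟨I, j⟩ h
    simp only [Finset.mem_sigma, Finset.mem_filter, Finset.mem_powersetCard_univ,
      Finset.mem_compl] at h
    obtain ⟨⟨hI, hi⟩, hj⟩ := h
    have : insert i ((insert j (I.erase i)).erase j) = I := by
      rw [Finset.erase_insert fun h => hj (Finset.mem_of_mem_erase h), Finset.insert_erase hi]
    simp only [this]
  · rintro ⟨R, j⟩ _
    rfl

theorem drift_ge {d K S : ℕ} {Φ Ψ : Dict d K} {κ r : ℝ} (hS : 1 ≤ S) (hSK : S < K)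
    (hκ1 : κ ^ 2 ≤ 1) (hunitΦ : Φ ∈ admissible d K) (hunitΨ : Ψ ∈ admissible d K)
    (hΨ : BoundedBelow Ψ (S + 1) κ) {i : Fin K} (hi : ‖Ψ i - Φ i‖ = r) (hr : r ≤ 1) :
    3 * κ ^ 2 * r ^ 2 / (4 * K * S) ≤ drift S Φ Ψ := by
  classical
  have hS0 : (0 : ℝ) < S := by exact_mod_cast hS
  have hKS : (0 : ℝ) < (K : ℝ) - S := by
    have : (S : ℝ) < K := by exact_mod_cast hSK
    linarith
  have hK0 : (0 : ℝ) < K := by linarith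
  have hC : (0 : ℝ) < (K.choose S : ℝ) := by exact_mod_cast Nat.choose_pos hSK.le
  set c : ℝ := inner ℝ (Φ i) (Ψ i) with hc
  set w := Φ i - c • Ψ i with hw
  have hr0 : 0 ≤ r := hi ▸ norm_nonneg _
  have hwi : inner ℝ w (Ψ i) = 0 := by
    rw [hw, inner_sub_left, inner_smul_left, real_inner_self_eq_norm_sq, hunitΨ i]
    simp [hc]
  have hwn : 3 / 4 * r ^ 2 ≤ ‖w‖ ^ 2 := by
    have h1 := norm_sub_sq_real (Ψ i) (Φ i)
    rw [hi, hunitΨ i, hunitΦ i, real_inner_comm, ← hc] at h1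
    have h2 : ‖w‖ ^ 2 = 1 - c ^ 2 := by
      rw [hw, norm_sub_sq_real, inner_smul_right, norm_smul, hunitΨ i, hunitΦ i, ← hc,
        Real.norm_eq_abs, mul_one, sq_abs]
      ring
    have h3 : c = 1 - r ^ 2 / 2 := by linarith
    rw [h2, h3]
    have : r ^ 2 ≤ 1 := pow_le_one₀ hr0 hr
    nlinarith [sq_nonneg r]
  set f : Finset (Fin K) → ℝ := fun I => ‖w - proj Ψ I w‖ ^ 2 with hf
  have hfI : ∀ I : Finset (Fin K), i ∈ I → f I = ‖Φ i - proj Ψ I (Φ i)‖ ^ 2 := by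
    intro I hiI
    have h1 : proj Ψ I (c • Ψ i) = c • Ψ i :=
      proj_of_mem Ψ I (Submodule.smul_mem _ _ (atom_mem_span Ψ hiI))
    simp only [hf, hw]
    rw [proj_sub, h1]
    congr 2
    abel
  have hlow : ∀ R ∈ powersetCard S (univ.erase i), κ ^ 2 / S * ‖w‖ ^ 2 ≤
      ∑ j ∈ R, f (insert i (R.erase j)) := by
    intro R hR
    simp only [Finset.mem_powersetCard, Finset.subset_erase] at hR
    have h := sum_norm_sub_proj_erase_sq_ge hS hκ1 hΨ hunitΨ (T := insert i R)
      (by rw [Finset.card_insert_of_notMem hR.1.2, hR.2]) (Finset.mem_insert_self i R) hwi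
    rw [Finset.erase_insert hR.1.2] at h
    refine h.trans (le_of_eq (Finset.sum_congr rfl fun j hj => ?_))
    have hij : i ≠ j := fun e => hR.1.2 (e ▸ hj)
    rw [Finset.erase_insert_of_ne hij]
  have h1 := Finset.sum_le_sum hlow
  rw [sum_sum_insert_erase hS hSK, Finset.sum_const, Finset.card_powersetCard,
    Finset.card_erase_of_mem (Finset.mem_univ i), Finset.card_univ, Fintype.card_fin,
    nsmul_eq_mul] at h1
  have hchoose : ((K - 1).choose S : ℝ) * K = (K.choose S : ℝ) * ((K : ℝ) - S) := by
    have h := Nat.choose_mul_succ_eq (K - 1) S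
    rw [Nat.sub_add_cancel (by omega)] at h
    rw [← Nat.cast_sub hSK.le]
    exact_mod_cast h
  have h2 : ∑ I ∈ (powersetCard S univ).filter (i ∈ ·), f I ≤
      ∑ I ∈ powersetCard S univ, ∑ k ∈ I, ‖Φ k - proj Ψ I (Φ k)‖ ^ 2 := by
    refine (Finset.sum_le_sum fun I hI => ?_).trans
      (Finset.sum_le_sum_of_subset_of_nonneg (Finset.filter_subset _ _) fun I _ _ =>
        Finset.sum_nonneg fun k _ => sq_nonneg _)
    have hiI := (Finset.mem_filter.1 hI).2
    rw [hfI I hiI]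
    exact Finset.single_le_sum (f := fun k => ‖Φ k - proj Ψ I (Φ k)‖ ^ 2)
      (fun k _ => sq_nonneg _) hiI
  rw [drift, div_le_div_iff₀ (by positivity) hC]
  set D := ∑ I ∈ powersetCard S univ, ∑ k ∈ I, ‖Φ k - proj Ψ I (Φ k)‖ ^ 2
  have h3 : ((K - 1).choose S : ℝ) * (κ ^ 2 / S * ‖w‖ ^ 2) ≤ ((K : ℝ) - S) * D :=
    h1.trans (by gcongr)
  have h4 : (K.choose S : ℝ) * (κ ^ 2 / S * ‖w‖ ^ 2) ≤ K * D := by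
    refine le_of_mul_le_mul_left ?_ hKS
    calc ((K : ℝ) - S) * ((K.choose S : ℝ) * (κ ^ 2 / S * ‖w‖ ^ 2)) =
          K * (((K - 1).choose S : ℝ) * (κ ^ 2 / S * ‖w‖ ^ 2)) := by
          linear_combination -(κ ^ 2 / S * ‖w‖ ^ 2) * hchoose
      _ ≤ K * (((K : ℝ) - S) * D) := by gcongr
      _ = _ := by ring
  have h5 : (K.choose S : ℝ) * (κ ^ 2 * ‖w‖ ^ 2) ≤ K * D * S := by
    have : (K.choose S : ℝ) * (κ ^ 2 * ‖w‖ ^ 2) =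
        (K.choose S : ℝ) * (κ ^ 2 / S * ‖w‖ ^ 2) * S := by field_simp
    rw [this]; gcongr
  have h6 : (K.choose S : ℝ) * (κ ^ 2 * (3 / 4 * r ^ 2)) ≤
      (K.choose S : ℝ) * (κ ^ 2 * ‖w‖ ^ 2) := by
    gcongr
  nlinarith

/-! ### The optimal index set does not change near the generating dictionary -/

/-- If every projection of `y` moves by at most half the margin, the maximiser over the index sets
stays the same. -/
theorem maxProjSq_eq_of_margin {d K S : ℕ} {Φ Ψ : Dict d K} {κ : ℝ} {y : Euc d}
    {I : Finset (Fin K)} (hI : #I = S)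
    (hm : ∀ J : Finset (Fin K), #J ≤ S → J ≠ I → 2 * κ ≤ ‖proj Φ I y‖ - ‖proj Φ J y‖)
    (hclose : ∀ J : Finset (Fin K), #J ≤ S → ‖proj Φ J y - proj Ψ J y‖ ≤ κ) :
    maxProjSq S Ψ y = ‖proj Ψ I y‖ ^ 2 := by
  refine le_antisymm (Finset.sup'_le _ _ fun J hJ => ?_)
    (Finset.le_sup' (fun I => ‖proj Ψ I y‖ ^ 2) (by simp [smallSets, hI]))
  have hJS : #J ≤ S := by simpa [smallSets] using hJ
  rcases eq_or_ne J I with rfl | hne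
  · exact le_rfl
  · have h1 := hm J hJS hne
    have h2 := hclose J hJS
    have h3 := hclose I hI.le
    have h4 := norm_sub_norm_le (proj Ψ J y) (proj Φ J y)
    rw [norm_sub_rev] at h4
    have h5 := norm_sub_norm_le (proj Φ I y) (proj Ψ I y)
    exact pow_le_pow_left₀ (norm_nonneg _) (by linarith) 2


/-! ### A lower tail bound -/

/-- Chernoff's bound for the lower tail of a sum of independent copies of a bounded variable `g`,
from `exp u ≤ 1 + u + u ^ 2` for `|u| ≤ 1`. -/
theorem measureReal_sum_le {E Ω : Type*} [MeasurableSpace E] [MeasurableSpace Ω] {N : ℕ}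
    {ν : Measure E} [IsProbabilityMeasure ν] {P : Measure Ω} [IsProbabilityMeasure P]
    {x : Fin N → Ω → E} (hlaw : ∀ n, HasLaw (x n) ν P) (hindep : iIndepFun x P)
    {g : E → ℝ} (hg : Measurable g) {M m v t : ℝ} (hM : ∀ᵐ z ∂ν, |g z| ≤ M)
    (hm : ∫ z, g z ∂ν = m) (hv : ∫ z, g z ^ 2 ∂ν ≤ v) (ht : 0 ≤ t) (htM : t * M ≤ 1) (θ : ℝ) :
    P.real {ω | ∑ n, g (x n ω) ≤ N * θ} ≤ Real.exp (-(N * (t * (m - θ) - t ^ 2 * v))) := by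
  have htg : ∀ᵐ z ∂ν, |-t * g z| ≤ 1 := by
    filter_upwards [hM] with z hz
    rw [abs_mul, abs_neg, abs_of_nonneg ht]
    exact (mul_le_mul_of_nonneg_left hz ht).trans htM
  have hexp_int : Integrable (fun z => Real.exp (-t * g z)) ν := by
    refine Integrable.of_bound (hg.const_mul (-t)).exp.aestronglyMeasurable (Real.exp 1) ?_
    filter_upwards [htg] with z hz
    rw [Real.norm_eq_abs, Real.abs_exp]
    exact Real.exp_le_exp.2 (le_of_abs_le hz)
  have hg_int : Integrable g ν := Integrable.of_bound hg.aestronglyMeasurable M hM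
  have hg2_int : Integrable (fun z => g z ^ 2) ν := by
    refine Integrable.of_bound (hg.pow_const 2).aestronglyMeasurable (M ^ 2) ?_
    filter_upwards [hM] with z hz
    rw [Real.norm_eq_abs, abs_pow]
    exact pow_le_pow_left₀ (abs_nonneg _) hz 2
  have hmgf : ∫ z, Real.exp (-t * g z) ∂ν ≤ Real.exp (-(t * m - t ^ 2 * v)) := by
    have h1 : ∫ z, Real.exp (-t * g z) ∂ν ≤ ∫ z, (1 + (-t) * g z + t ^ 2 * g z ^ 2) ∂ν := by
      refine integral_mono_ae hexp_int
        (((integrable_const _).add (hg_int.const_mul _)).add (hg2_int.const_mul _)) ?_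
      filter_upwards [htg] with z hz
      have := le_of_abs_le (Real.abs_exp_sub_one_sub_id_le hz)
      linarith [mul_pow (-t) (g z) 2, neg_sq t]
    have h0 : Integrable (fun z => 1 + -t * g z) ν := (integrable_const _).add (hg_int.const_mul _)
    rw [integral_add h0 (hg2_int.const_mul _),
      integral_add (integrable_const _) (hg_int.const_mul _), integral_const_mul,
      integral_const_mul, hm, integral_const, probReal_univ, one_smul] at h1
    have h2 := Real.add_one_le_exp (-(t * m - t ^ 2 * v))
    have h3 : t ^ 2 * ∫ z, g z ^ 2 ∂ν ≤ t ^ 2 * v := by gcongr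
    linarith
  have hmeas : ∀ n, AEMeasurable (fun ω => g (x n ω)) P := fun n =>
    hg.comp_aemeasurable (hlaw n).aemeasurable
  have hind : iIndepFun (fun n ω => g (x n ω)) P := hindep.comp (fun _ => g) fun _ => hg
  have hmgf_n : ∀ n, mgf (fun ω => g (x n ω)) P (-t) ≤ Real.exp (-(t * m - t ^ 2 * v)) := by
    intro n
    have : mgf (fun ω => g (x n ω)) P (-t) = ∫ z, Real.exp (-t * g z) ∂ν := by
      rw [mgf, ← (hlaw n).map_eq, integral_map (hlaw n).aemeasurable]
      exact (hg.const_mul (-t)).exp.aestronglyMeasurable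
    rw [this]
    exact hmgf
  have hint : Integrable (fun ω => Real.exp (-t * (∑ n, fun ω => g (x n ω)) ω)) P := by
    refine Integrable.of_bound
      ((Finset.aemeasurable_sum _ fun n _ => hmeas n).const_mul (-t)).exp.aestronglyMeasurable
      (Real.exp (∑ _n : Fin N, 1)) ?_
    have h : ∀ᵐ ω ∂P, ∀ n, |-t * g (x n ω)| ≤ 1 := by
      refine ae_all_iff.2 fun n => ?_
      have h' := htg
      rw [← (hlaw n).map_eq] at h'
      exact ae_of_ae_map (hlaw n).aemeasurable h'
    filter_upwards [h] with ω hω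
    rw [Real.norm_eq_abs, Real.abs_exp, Finset.sum_apply, Finset.mul_sum]
    exact Real.exp_le_exp.2 (Finset.sum_le_sum fun n _ => le_of_abs_le (hω n))
  have hch := measure_le_le_exp_mul_mgf (μ := P) (N * θ) (neg_nonpos.2 ht) hint
  rw [hind.mgf_sum₀ hmeas] at hch
  simp only [Finset.sum_apply] at hch
  refine hch.trans ?_
  have hprod : ∏ n : Fin N, mgf (fun ω => g (x n ω)) P (-t) ≤
      Real.exp (-(t * m - t ^ 2 * v)) ^ N := by
    have := Finset.prod_le_prod (s := (univ : Finset (Fin N)))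
      (fun n _ => mgf_nonneg (X := fun ω => g (x n ω)) (μ := P) (t := -t))
      fun n _ => hmgf_n n
    simpa using this
  calc _ ≤ Real.exp (- -t * (N * θ)) * Real.exp (-(t * m - t ^ 2 * v)) ^ N := by gcongr
    _ = _ := by
      rw [← Real.exp_nat_mul, ← Real.exp_add]
      congr 1
      ring

section

variable {d K S N : ℕ} {Φ : Dict d K} {A κ : ℝ} {ν : Measure (Euc K)} [IsProbabilityMeasure ν]
  {Ω : Type*} [MeasurableSpace Ω] {P : Measure Ω} [IsProbabilityMeasure P]

/-- The total loss of a fixed perturbed dictionary is, with high probability, at least an eighth of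
its mean. -/
theorem measureReal_sum_gap_le (hS : 1 ≤ S) (hSK : S < K) (hunit : Φ ∈ admissible d K)
    (hA : A = (K : ℝ) / (d : ℝ)) (hframe : IsTightFrame Φ A) (hκ : 0 < κ)
    (hmargin : HasMargin Φ S ν κ) (hsphere : ∀ᵐ x ∂ν, ‖x‖ = 1) (hsymm : IsSymmetric ν)
    {x : Fin N → Ω → Euc K} (hlaw : ∀ n, HasLaw (x n) ν P) (hindep : iIndepFun x P)
    {Ψ : Dict d K} (hΦ : BoundedBelow Φ (S + 1) κ) (hΨ : BoundedBelow Ψ (S + 1) κ) :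
    P.real {ω | ∑ n, gap S Φ Ψ (x n ω) ≤ N * (lambdaS ν S * drift S Φ Ψ / 8)} ≤
      Real.exp (-(N * (lambdaS ν S ^ 2 * drift S Φ Ψ * (S * κ ^ 2) / (64 * A)))) := by
  have hS1 : (1 : ℝ) ≤ S := by exact_mod_cast hS
  have hA0 := hframe.1
  set lam := lambdaS ν S with hlam
  have hlam4 : 4 * κ ^ 2 ≤ lam :=
    four_mul_sq_le_lambdaS hS hSK hunit hframe hκ hmargin hsphere hsymm
  have hlam1 : lam * S ≤ 1 := lambdaS_mul_le_one hS hSK hκ hmargin hsphere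
  have hκ0 : 0 < κ ^ 2 := by positivity
  have hlam0 : 0 < lam := by linarith
  have hκ1 : κ ^ 2 ≤ 1 := by nlinarith
  have hM : ∀ᵐ z ∂ν, |gap S Φ Ψ z| ≤ A := by
    filter_upwards [hmargin.ae_exists_cell hSK hκ, hsphere] with x ⟨I, hI, hx, _, _⟩ hx1
    exact gap_abs_le hframe hI hx hx1 Ψ
  have h := measureReal_sum_le hlaw hindep (measurable_gap S Φ Ψ) hM
    (integral_gap hS hSK hframe hκ hmargin hsphere hsymm hΨ)
    (integral_gap_sq_le hS hSK hunit hA hframe hκ hmargin hsphere hsymm hΦ hΨ)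
    -- With `v = B * drift` the bound of the second moment, `t = lam / (2 * B)` minimises
    -- `t ^ 2 * v - t * (lam * drift)`.
    (t := lam * (S * κ ^ 2) / (24 * A)) (by positivity)
    (by
      rw [div_mul_eq_mul_div, div_le_one (by positivity)]
      have : lam * (S * κ ^ 2) ≤ 1 := by
        calc lam * (S * κ ^ 2) = (lam * S) * κ ^ 2 := by ring
          _ ≤ 1 * 1 := by gcongr
          _ = 1 := one_mul 1
      nlinarith) (lam * drift S Φ Ψ / 8)
  refine h.trans (le_of_eq ?_)
  congr 2
  have hS0 : (S : ℝ) ≠ 0 := by positivity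
  rw [← hlam]
  field_simp
  ring

end


/-! ### From the empirical criterion to the K-SVD cost -/

theorem synth_mem_span {d K : ℕ} (Ψ : Dict d K) (x : Euc K) :
    synth Ψ x ∈ atomSpan Ψ (univ.filter fun i => x i ≠ 0) := by
  classical
  have : synth Ψ x = ∑ i ∈ univ.filter (fun i => x i ≠ 0), x i • Ψ i := by
    rw [synth, Finset.sum_filter_of_ne]
    intro i _ h hx
    exact h (by rw [hx, zero_smul])
  rw [this]
  exact sum_smul_mem_span Ψ _ fun i => x i

theorem le_norm_sub_synth_sq {d K S : ℕ} (Ψ : Dict d K) (y : Euc d) {x : Euc K}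
    (hx : #(univ.filter fun i => x i ≠ 0) ≤ S) :
    ‖y‖ ^ 2 - maxProjSq S Ψ y ≤ ‖y - synth Ψ x‖ ^ 2 := by
  set I := univ.filter fun i => x i ≠ 0 with hI
  have h1 : ‖proj Ψ I y‖ ^ 2 ≤ maxProjSq S Ψ y :=
    Finset.le_sup' (fun I => ‖proj Ψ I y‖ ^ 2) (by simpa [smallSets] using hx)
  have h2 := norm_sub_sq_of_mem Ψ I (synth_mem_span Ψ x) y
  have h3 := norm_sq_eq_proj Ψ I y
  nlinarith [sq_nonneg ‖proj Ψ I y - synth Ψ x‖]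

theorem exists_norm_sub_synth_sq_eq {d K S : ℕ} (Ψ : Dict d K) (y : Euc d) :
    ∃ x : Euc K, #(univ.filter fun i => x i ≠ 0) ≤ S ∧
      ‖y - synth Ψ x‖ ^ 2 = ‖y‖ ^ 2 - maxProjSq S Ψ y := by
  classical
  obtain ⟨I, hI, hmax⟩ := Finset.exists_mem_eq_sup' (smallSets_nonempty K S)
    fun I => ‖proj Ψ I y‖ ^ 2
  obtain ⟨a, ha⟩ := exists_coeff (proj_mem Ψ I y)
  let x : Euc K := WithLp.toLp 2 fun i => if i ∈ I then a i else 0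
  refine ⟨x, ?_, ?_⟩
  · have hsub : (univ.filter fun i => x i ≠ 0) ⊆ I := by
      intro i hi
      by_contra h
      simp [x, h] at hi
    exact (Finset.card_le_card hsub).trans (by simpa [smallSets] using hI)
  · have : synth Ψ x = proj Ψ I y := by
      rw [ha, synth]
      simp [x, ite_smul]
    rw [this, maxProjSq, hmax, norm_sq_eq_proj Ψ I y]
    ring

section

variable {d K S N : ℕ} (Y : Fin N → Euc d) (Ψ : Dict d K)

theorem le_ksvdCost {X : Fin N → Euc K} (hX : X ∈ sparseCoeffs K N S) :
    ∑ n, (‖Y n‖ ^ 2 - maxProjSq S Ψ (Y n)) ≤ ksvdCost Y Ψ X :=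
  Finset.sum_le_sum fun n _ => le_norm_sub_synth_sq Ψ (Y n) (hX n)

theorem exists_ksvdCost_eq : ∃ X ∈ sparseCoeffs K N S,
    ksvdCost Y Ψ X = ∑ n, (‖Y n‖ ^ 2 - maxProjSq S Ψ (Y n)) := by
  choose X hX hX' using fun n => exists_norm_sub_synth_sq_eq (S := S) Ψ (Y n)
  exact ⟨X, hX, Finset.sum_congr rfl fun n _ => hX' n⟩

theorem ksvdCriterion_eq :
    ksvdCriterion S Y Ψ = ∑ n, (‖Y n‖ ^ 2 - maxProjSq S Ψ (Y n)) := by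
  obtain ⟨X, hX, hXe⟩ := exists_ksvdCost_eq (S := S) Y Ψ
  have : Nonempty (sparseCoeffs K N S) := ⟨⟨X, hX⟩⟩
  refine le_antisymm ?_ (le_ciInf fun X => le_ksvdCost Y Ψ X.2)
  rw [← hXe]
  exact ciInf_le (f := fun X : sparseCoeffs K N S => ksvdCost Y Ψ X)
    ⟨_, by rintro _ ⟨X, rfl⟩; exact le_ksvdCost Y Ψ X.2⟩ ⟨X, hX⟩

theorem empiricalCriterion_le_iff (hN : 1 ≤ N) (Ψ' : Dict d K) :
    empiricalCriterion S Y Ψ' ≤ empiricalCriterion S Y Ψ ↔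
      ∑ n, maxProjSq S Ψ' (Y n) ≤ ∑ n, maxProjSq S Ψ (Y n) := by
  have hN0 : (0 : ℝ) < 1 / (N : ℝ) := by
    have : (0 : ℝ) < N := by exact_mod_cast hN
    positivity
  exact mul_le_mul_iff_right₀ hN0

end

/-- A local maximum of the empirical criterion is a local minimum of the K-SVD problem. -/
theorem hasLocalOptimumWithin_of_isLocalMaxOn {d K S N : ℕ} (hN : 1 ≤ N) (Y : Fin N → Euc d)
    {Φ Ψ : Dict d K} {r : ℝ} (hΨ : Ψ ∈ admissible d K) (hr : ∀ k, ‖Ψ k - Φ k‖ ≤ r)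
    (hmax : IsLocalMaxOn (empiricalCriterion S Y) (admissible d K) Ψ) :
    HasLocalOptimumWithin S Y Φ r := by
  have hmin : IsLocalMinOn (ksvdCriterion S Y) (admissible d K) Ψ := by
    filter_upwards [hmax] with Ψ' hΨ'
    have h := (empiricalCriterion_le_iff Y Ψ hN Ψ').1 hΨ'
    rw [ksvdCriterion_eq, ksvdCriterion_eq, Finset.sum_sub_distrib, Finset.sum_sub_distrib]
    linarith
  obtain ⟨X, hX, hXe⟩ := exists_ksvdCost_eq (S := S) Y Ψ
  refine ⟨Ψ, hΨ, hr, hmax, hmin, X, hX, fun X' hX' => ?_, ?_⟩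
  · exact hXe.le.trans (le_ksvdCost Y Ψ hX')
  · have h1 : Filter.Tendsto (Prod.fst : Dict d K × (Fin N → Euc K) → Dict d K)
        (nhdsWithin (Ψ, X) (admissible d K ×ˢ sparseCoeffs K N S))
        (nhdsWithin Ψ (admissible d K)) := by
      rw [nhdsWithin_prod_eq]
      exact Filter.tendsto_fst
    filter_upwards [h1.eventually hmin, self_mem_nhdsWithin] with q hq hq'
    have h2 := le_ksvdCost Y q.1 hq'.2
    rw [← ksvdCriterion_eq] at h2 hXe
    exact hXe.le.trans (hq.trans h2)

/-! ### The neighbourhood of the generating dictionary -/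

/-- The admissible dictionaries with all atoms within distance `r` of the ones of `Φ`. -/
def nearDicts {d K : ℕ} (Φ : Dict d K) (r : ℝ) : Set (Dict d K) :=
  {Ψ | Ψ ∈ admissible d K ∧ ∀ k, ‖Ψ k - Φ k‖ ≤ r}

theorem isCompact_nearDicts {d K : ℕ} (Φ : Dict d K) (r : ℝ) : IsCompact (nearDicts Φ r) := by
  have h1 : IsCompact (Set.univ.pi fun k => Metric.closedBall (Φ k) r) :=
    isCompact_univ_pi fun k => isCompact_closedBall _ _
  have h2 : IsClosed (admissible d K) := by
    simp only [admissible, Set.ofPred_forall]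
    exact isClosed_iInter fun k => isClosed_eq (by fun_prop) continuous_const
  have : nearDicts Φ r = admissible d K ∩ Set.univ.pi fun k => Metric.closedBall (Φ k) r := by
    ext Ψ
    simp [nearDicts, dist_eq_norm]
  rw [this]
  exact h1.inter_left h2

/-- The criterion is continuous as long as the relevant sets of atoms do not lose rank. -/
theorem continuousOn_maxProjSq {d K S : ℕ} {κ : ℝ} (hκ : 0 < κ) {B : Set (Dict d K)}
    (hB : ∀ Ψ ∈ B, BoundedBelow Ψ (S + 1) κ) (y : Euc d) :
    ContinuousOn (fun Ψ => maxProjSq S Ψ y) B := by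
  unfold maxProjSq
  refine ContinuousOn.finset_sup'_apply _ fun I hI => ?_
  have hIS : #I ≤ S + 1 := by
    have : #I ≤ S := by simpa [smallSets] using hI
    omega
  refine (ContinuousOn.norm ?_).pow 2
  have hlip : LipschitzOnWith (2 * √((S + 1 : ℕ) : ℝ) * ‖y‖ / κ).toNNReal
      (fun Ψ => proj Ψ I y) B := by
    refine LipschitzOnWith.of_dist_le_mul fun Ψ hΨ Ψ' hΨ' => ?_
    have h := norm_proj_sub_proj_le (hB Ψ hΨ) (hB Ψ' hΨ') hκ (dist_nonneg (x := Ψ) (y := Ψ'))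
      (fun k => by rw [← dist_eq_norm, dist_comm]; exact dist_le_pi_dist Ψ Ψ' k) hIS y
    rw [Real.coe_toNNReal _ (by positivity), dist_eq_norm, div_mul_eq_mul_div,
      le_div_iff₀ hκ]
    linarith
  exact hlip.continuousOn

/-- If the criterion is smaller on the whole boundary of the neighbourhood than at `Φ`, its
maximiser over the neighbourhood is interior, hence a local maximum. -/
theorem hasLocalOptimumWithin_of_boundary {d K S N : ℕ} (hN : 1 ≤ N) (Y : Fin N → Euc d)
    {Φ : Dict d K} {r κ : ℝ} (hκ : 0 < κ) (hr : 0 ≤ r) (hΦ : Φ ∈ admissible d K)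
    (hB : ∀ Ψ ∈ nearDicts Φ r, BoundedBelow Ψ (S + 1) κ)
    (hbd : ∀ Ψ ∈ nearDicts Φ r, (∃ k, ‖Ψ k - Φ k‖ = r) →
      ∑ n, maxProjSq S Ψ (Y n) < ∑ n, maxProjSq S Φ (Y n)) :
    HasLocalOptimumWithin S Y Φ r := by
  have hΦn : Φ ∈ nearDicts Φ r := ⟨hΦ, fun k => by simpa using hr⟩
  obtain ⟨Ψ, hΨ, hmax⟩ := (isCompact_nearDicts Φ r).exists_isMaxOn ⟨Φ, hΦn⟩
    (f := fun Ψ => ∑ n, maxProjSq S Ψ (Y n))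
    (continuousOn_finsetSum _ fun n _ => continuousOn_maxProjSq hκ hB (Y n))
  have hlt : ∀ k, ‖Ψ k - Φ k‖ < r := by
    intro k
    refine lt_of_le_of_ne (hΨ.2 k) fun h => ?_
    exact absurd (hmax hΦn) (not_le.2 (hbd Ψ hΨ ⟨k, h⟩))
  refine hasLocalOptimumWithin_of_isLocalMaxOn hN Y hΨ.1 hΨ.2 ?_
  have hev : ∀ᶠ Ψ' in nhds Ψ, ∀ k, ‖Ψ' k - Φ k‖ < r := by
    refine Filter.eventually_all.2 fun k => ?_
    have hc : Continuous fun Ψ' : Dict d K => ‖Ψ' k - Φ k‖ := by fun_prop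
    exact hc.continuousAt.eventually_lt continuousAt_const (hlt k)
  filter_upwards [nhdsWithin_le_nhds hev, self_mem_nhdsWithin] with Ψ' h h'
  exact (empiricalCriterion_le_iff Y Ψ hN Ψ').2 (hmax ⟨h', fun k => (h k).le⟩)


/-! ### A finite net and the union bound -/

/-- A net of a set of dictionaries close to `Φ`, with points in the set, from a grid on the
coordinates with mesh `s`. -/
theorem exists_finset_net {d K : ℕ} (Φ : Dict d K) {B : Set (Dict d K)} {r s : ℝ} (hs : 0 < s)
    (hB : ∀ Ψ ∈ B, ∀ k, ‖Ψ k - Φ k‖ ≤ r) :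
    ∃ F : Finset (Dict d K), (∀ Ψ ∈ F, Ψ ∈ B) ∧ #F ≤ (2 * ⌈r / s⌉₊ + 1) ^ (K * d) ∧
      ∀ Ψ ∈ B, ∃ Ψ' ∈ F, ∀ k, ‖Ψ k - Ψ' k‖ ≤ √(d : ℝ) * s := by
  classical
  set M := ⌈r / s⌉₊ with hM
  -- The cell of the grid that contains a dictionary; a net picks one point of `B` in each cell.
  let code : Dict d K → Fin K → Fin d → ℤ := fun Ψ k j => ⌊(Ψ k j - Φ k j) / s⌋
  let codes : Finset (Fin K → Fin d → ℤ) :=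
    Fintype.piFinset fun _ => Fintype.piFinset fun _ => Finset.Icc (-(M : ℤ)) M
  have hcard : #codes = (2 * M + 1) ^ (K * d) := by
    simp only [codes, Fintype.card_piFinset, Int.card_Icc, Finset.prod_const, Finset.card_univ,
      Fintype.card_fin]
    rw [← pow_mul, mul_comm K d]
    congr 1
    omega
  have hmem : ∀ Ψ ∈ B, code Ψ ∈ codes := by
    intro Ψ hΨ
    simp only [codes, Fintype.mem_piFinset, Finset.mem_Icc]
    intro k j
    have h1 : |Ψ k j - Φ k j| ≤ r := by
      have := PiLp.norm_apply_le (Ψ k - Φ k) j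
      exact this.trans (hB Ψ hΨ k)
    have h2 : |(Ψ k j - Φ k j) / s| ≤ M := by
      rw [abs_div, abs_of_pos hs]
      exact ((div_le_div_iff_of_pos_right hs).2 h1).trans (Nat.le_ceil _)
    rw [abs_le] at h2
    refine ⟨Int.le_floor.2 (by push_cast; exact h2.1), ?_⟩
    have h3 : ((code Ψ k j : ℤ) : ℝ) ≤ M := (Int.floor_le _).trans h2.2
    exact_mod_cast h3
  have hrep : ∀ c : Fin K → Fin d → ℤ, ∃ Ψ, (∃ Ψ' ∈ B, code Ψ' = c) → Ψ ∈ B ∧ code Ψ = c := by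
    intro c
    by_cases h : ∃ Ψ' ∈ B, code Ψ' = c
    · obtain ⟨Ψ', h1, h2⟩ := h
      exact ⟨Ψ', fun _ => ⟨h1, h2⟩⟩
    · exact ⟨Φ, fun h' => absurd h' h⟩
  choose rep hrep using hrep
  refine ⟨(codes.filter fun c => ∃ Ψ' ∈ B, code Ψ' = c).image rep, ?_, ?_, ?_⟩
  · intro Ψ hΨ
    obtain ⟨c, hc, rfl⟩ := Finset.mem_image.1 hΨ
    exact (hrep c (Finset.mem_filter.1 hc).2).1
  · exact Finset.card_image_le.trans ((Finset.card_filter_le _ _).trans hcard.le)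
  · intro Ψ hΨ
    have hex : ∃ Ψ' ∈ B, code Ψ' = code Ψ := ⟨Ψ, hΨ, rfl⟩
    refine ⟨rep (code Ψ), Finset.mem_image.2 ⟨_, Finset.mem_filter.2 ⟨hmem Ψ hΨ, hex⟩, rfl⟩,
      fun k => ?_⟩
    have hc := (hrep _ hex).2
    have hj : ∀ j, (Ψ k j - rep (code Ψ) k j) ^ 2 ≤ s ^ 2 := by
      intro j
      have h1 : ⌊(rep (code Ψ) k j - Φ k j) / s⌋ = ⌊(Ψ k j - Φ k j) / s⌋ :=
        congrFun (congrFun hc k) j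
      have h2 := Int.abs_sub_lt_one_of_floor_eq_floor h1
      rw [← sub_div, abs_div, abs_of_pos hs, div_lt_one hs] at h2
      rw [← sq_abs]
      refine pow_le_pow_left₀ (abs_nonneg _) ?_ 2
      have : Ψ k j - rep (code Ψ) k j =
        -(rep (code Ψ) k j - Φ k j - (Ψ k j - Φ k j)) := by ring
      rw [this, abs_neg]
      exact h2.le
    have h3 : ‖Ψ k - rep (code Ψ) k‖ ^ 2 ≤ (√(d : ℝ) * s) ^ 2 := by
      rw [EuclideanSpace.real_norm_sq_eq, mul_pow, Real.sq_sqrt (by positivity)]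
      refine (Finset.sum_le_sum fun j _ => hj j).trans ?_
      simp
    exact le_of_abs_le (abs_le_of_sq_le_sq h3 (by positivity))

section

variable {d K S N : ℕ} {Φ : Dict d K} {A κ r : ℝ} {ν : Measure (Euc K)} [IsProbabilityMeasure ν]
  {Ω : Type*} [MeasurableSpace Ω] {P : Measure Ω} [IsProbabilityMeasure P]

theorem gap_sub_gap_le (hframe : IsTightFrame Φ A) (hκ : 0 < κ) {Ψ Ψ' : Dict d K}
    (hΨ : BoundedBelow Ψ (S + 1) κ) (hΨ' : BoundedBelow Ψ' (S + 1) κ) {h : ℝ} (hh : 0 ≤ h)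
    (hclose : ∀ k, ‖Ψ k - Ψ' k‖ ≤ h) {I : Finset (Fin K)} (hI : #I = S) {x : Euc K}
    (hx : x ∈ cell I) (hx1 : ‖x‖ = 1) :
    gap S Φ Ψ' x - gap S Φ Ψ x ≤ 4 * h * A * √((S + 1 : ℕ) : ℝ) / κ := by
  rw [gap_eq Φ Ψ hI hx, gap_eq Φ Ψ' hI hx]
  have hy := hframe.norm_synth_sq_le x
  rw [hx1, one_pow, mul_one] at hy
  set y := synth Φ x
  have h1 := norm_proj_sub_proj_le hΨ' hΨ hκ hh hclose (hI.le.trans (Nat.le_succ S)) y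
  have h2 := norm_proj_le Ψ I y
  have h3 := norm_proj_le Ψ' I y
  have h4 := norm_sub_norm_le (proj Ψ I y) (proj Ψ' I y)
  rw [norm_sub_rev] at h4
  rw [le_div_iff₀ hκ]
  set σ := √((S + 1 : ℕ) : ℝ)
  have hσ : 0 ≤ σ := Real.sqrt_nonneg _
  set δ := ‖proj Ψ' I y - proj Ψ I y‖
  set u := ‖proj Ψ I y‖
  set u' := ‖proj Ψ' I y‖
  have hu : 0 ≤ u := norm_nonneg _
  have hu' : 0 ≤ u' := norm_nonneg _
  have hδ : 0 ≤ δ := norm_nonneg _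
  have hy0 : 0 ≤ ‖y‖ := norm_nonneg _
  calc (‖proj Φ I y‖ ^ 2 - u' ^ 2 - (‖proj Φ I y‖ ^ 2 - u ^ 2)) * κ
        = (u - u') * (u + u') * κ := by ring
    _ ≤ δ * (‖y‖ + ‖y‖) * κ := by gcongr
    _ = (κ * δ) * (2 * ‖y‖) := by ring
    _ ≤ (2 * h * σ * ‖y‖) * (2 * ‖y‖) := by gcongr
    _ = 4 * h * ‖y‖ ^ 2 * σ := by ring
    _ ≤ 4 * h * A * σ := by gcongr

/-- The probability that there is no local optimum within distance `r`: the losses are bounded below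
on a net of the boundary of the neighbourhood, hence positive on the whole boundary. -/
theorem measure_not_hasLocalOptimumWithin_le (hS : 1 ≤ S) (hSK : S < K) (hN : 1 ≤ N)
    (hunit : Φ ∈ admissible d K)
    (hA : A = (K : ℝ) / (d : ℝ)) (hframe : IsTightFrame Φ A) (hκ : 0 < κ)
    (hmargin : HasMargin Φ S ν κ) (hsphere : ∀ᵐ x ∂ν, ‖x‖ = 1) (hsymm : IsSymmetric ν)
    {x : Fin N → Ω → Euc K} (hlaw : ∀ n, HasLaw (x n) ν P) (hindep : iIndepFun x P)
    (hr : 0 < r) (hr1 : r ≤ 1) (hrκ : κ + r * √((S + 1 : ℕ) : ℝ) ≤ √2 * κ)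
    (hrA : 2 * r * √((S + 1 : ℕ) : ℝ) * √A ≤ κ ^ 2) :
    P {ω | ¬ HasLocalOptimumWithin S (fun n => synth Φ (x n ω)) Φ r} ≤
      ENNReal.ofReal
        ((2 * ⌈128 * A * K * S * √((S + 1 : ℕ) : ℝ) * √(d : ℝ) /
          (3 * lambdaS ν S * κ ^ 3 * r)⌉₊ + 1 : ℝ) ^ (K * d) *
        Real.exp (-(N * (3 * lambdaS ν S ^ 2 * κ ^ 4 * r ^ 2 / (256 * K * A))))) := by
  classical
  have hS1 : (1 : ℝ) ≤ S := by exact_mod_cast hS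
  have hA0 := hframe.1
  have hK0 : (0 : ℝ) < K := by
    have : 0 < K := by omega
    exact_mod_cast this
  have hd0 : (0 : ℝ) < d := by
    rcases Nat.eq_zero_or_pos d with rfl | h
    · simp at hA; linarith
    · exact_mod_cast h
  have hN0 : (0 : ℝ) < N := by exact_mod_cast hN
  have hlam4 : 4 * κ ^ 2 ≤ lambdaS ν S :=
    four_mul_sq_le_lambdaS hS hSK hunit hframe hκ hmargin hsphere hsymm
  have hlam1 : lambdaS ν S * S ≤ 1 := lambdaS_mul_le_one hS hSK hκ hmargin hsphere
  set lam := lambdaS ν S with hlam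
  have hκ0 : 0 < κ ^ 2 := by positivity
  have hlam0 : 0 < lam := by linarith
  have hκ1 : κ ^ 2 ≤ 1 := by nlinarith
  have hB : ∀ Ψ ∈ nearDicts Φ r, BoundedBelow Ψ (S + 1) κ := fun Ψ hΨ =>
    (boundedBelow_of_margin hS hSK hunit hframe hκ hmargin hsphere hsymm).perturb hκ.le hr.le
      hΨ.2 hrκ
  have hΦn : Φ ∈ nearDicts Φ r := ⟨hunit, fun k => by simpa using hr.le⟩
  set σ := √((S + 1 : ℕ) : ℝ) with hσ
  have hσ0 : 0 < σ := Real.sqrt_pos.2 (by positivity)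
  set D := 3 * κ ^ 2 * r ^ 2 / (4 * K * S) with hD
  have hD0 : 0 < D := by positivity
  -- The resolution of the net: a move by `h` changes each loss by at most `lam * D / 8`.
  set h := lam * D * κ / (32 * A * σ) with hh
  have hh0 : 0 < h := by positivity
  set bd : Set (Dict d K) := {Ψ | Ψ ∈ nearDicts Φ r ∧ ∃ k, ‖Ψ k - Φ k‖ = r} with hbd
  obtain ⟨F, hFB, hFcard, hFnet⟩ := exists_finset_net Φ (B := bd) (r := r) (s := h / √(d : ℝ))
    (by positivity) fun Ψ hΨ => hΨ.1.2
  have hdsqrt : √(d : ℝ) * (h / √(d : ℝ)) = h := by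
    have : √(d : ℝ) ≠ 0 := (Real.sqrt_pos.2 hd0).ne'
    field_simp
  rw [hdsqrt] at hFnet
  have hceil : r / (h / √(d : ℝ)) = 128 * A * K * S * σ * √(d : ℝ) / (3 * lam * κ ^ 3 * r) := by
    rw [hh, hD]
    have : √(d : ℝ) ≠ 0 := (Real.sqrt_pos.2 hd0).ne'
    field_simp
    ring
  rw [hceil] at hFcard
  set m := ⌈128 * A * K * S * σ * √(d : ℝ) / (3 * lam * κ ^ 3 * r)⌉₊ with hm
  set E := Real.exp (-(N * (3 * lam ^ 2 * κ ^ 4 * r ^ 2 / (256 * K * A)))) with hE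
  let bad : Dict d K → Set Ω :=
    fun Ψ => {ω | ∑ n, gap S Φ Ψ (x n ω) ≤ N * (lam * drift S Φ Ψ / 8)}
  have hdrift : ∀ Ψ ∈ bd, D ≤ drift S Φ Ψ := by
    rintro Ψ ⟨hΨ, k, hk⟩
    exact drift_ge hS hSK hκ1 hunit hΨ.1 (hB Ψ hΨ) hk hr1
  have hbad : ∀ Ψ ∈ F, P (bad Ψ) ≤ ENNReal.ofReal E := by
    intro Ψ hΨ
    have hΨb := hFB Ψ hΨ
    have h1 := measureReal_sum_gap_le hS hSK hunit hA hframe hκ hmargin hsphere hsymm hlaw hindep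
      (hB Φ hΦn) (hB Ψ hΨb.1)
    rw [← ofReal_measureReal]
    refine ENNReal.ofReal_le_ofReal (h1.trans (Real.exp_le_exp.2 (neg_le_neg ?_)))
    refine mul_le_mul_of_nonneg_left ?_ hN0.le
    calc 3 * lam ^ 2 * κ ^ 4 * r ^ 2 / (256 * K * A) = lam ^ 2 * D * (S * κ ^ 2) / (64 * A) := by
          rw [hD]; field_simp; ring
      _ ≤ _ := by gcongr; exact hdrift Ψ hΨb
  have hgood : ∀ᵐ ω ∂P, ∀ n, ‖x n ω‖ = 1 ∧ ∃ I : Finset (Fin K), #I = S ∧ x n ω ∈ cell I ∧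
      (∀ J : Finset (Fin K), #J ≤ S → J ≠ I →
        2 * κ ≤ ‖proj Φ I (synth Φ (x n ω))‖ - ‖proj Φ J (synth Φ (x n ω))‖) := by
    refine ae_all_iff.2 fun n => ?_
    have h' : ∀ᵐ z ∂ν, ‖z‖ = 1 ∧ ∃ I : Finset (Fin K), #I = S ∧ z ∈ cell I ∧
      (∀ J : Finset (Fin K), #J ≤ S → J ≠ I →
        2 * κ ≤ ‖proj Φ I (synth Φ z)‖ - ‖proj Φ J (synth Φ z)‖) := by
      filter_upwards [hsphere, hmargin.ae_exists_cell hSK hκ] with z hz ⟨I, h1, h2, h3, _⟩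
      exact ⟨hz, I, h1, h2, h3⟩
    rw [← (hlaw n).map_eq] at h'
    exact ae_of_ae_map (hlaw n).aemeasurable h'
  have hsub : {ω | ¬ HasLocalOptimumWithin S (fun n => synth Φ (x n ω)) Φ r} ≤ᵐ[P]
      ⋃ Ψ ∈ F, bad Ψ := by
    filter_upwards [hgood] with ω hω hnot
    by_contra hcon
    refine hnot ?_
    have hpos : ∀ Ψ ∈ F, N * (lam * drift S Φ Ψ / 8) < ∑ n, gap S Φ Ψ (x n ω) := by
      intro Ψ hΨ
      by_contra! hc
      exact hcon (Set.mem_iUnion₂.2 ⟨Ψ, hΨ, hc⟩)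
    have hmax : ∀ Ψ ∈ nearDicts Φ r, ∀ n, maxProjSq S Ψ (synth Φ (x n ω)) =
        maxProjSq S Φ (synth Φ (x n ω)) - gap S Φ Ψ (x n ω) := by
      have hsel : ∀ Ψ ∈ nearDicts Φ r, ∀ n (I : Finset (Fin K)), #I = S → x n ω ∈ cell I →
          (∀ J : Finset (Fin K), #J ≤ S → J ≠ I →
            2 * κ ≤ ‖proj Φ I (synth Φ (x n ω))‖ - ‖proj Φ J (synth Φ (x n ω))‖) →
          maxProjSq S Ψ (synth Φ (x n ω)) = ‖proj Ψ I (synth Φ (x n ω))‖ ^ 2 := by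
        intro Ψ hΨ n I hI _ hmarg
        refine maxProjSq_eq_of_margin hI hmarg fun J hJ => ?_
        have h1 := norm_proj_sub_proj_le (hB Φ hΦn) (hB Ψ hΨ) hκ hr.le hΨ.2
          (hJ.trans (Nat.le_succ S)) (synth Φ (x n ω))
        have h2 : ‖synth Φ (x n ω)‖ ≤ √A := by
          have := hframe.norm_synth_sq_le (x n ω)
          rw [(hω n).1, one_pow, mul_one] at this
          exact Real.le_sqrt_of_sq_le this
        refine le_of_mul_le_mul_left ?_ hκ
        calc _ ≤ _ := h1
          _ ≤ 2 * r * σ * √A := by gcongr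
          _ ≤ κ ^ 2 := hrA
          _ = κ * κ := sq κ
      intro Ψ hΨ n
      obtain ⟨-, I, hI, hx, hmarg⟩ := hω n
      rw [hsel Ψ hΨ n I hI hx hmarg, hsel Φ hΦn n I hI hx hmarg, gap_eq Φ Ψ hI hx]
      ring
    refine hasLocalOptimumWithin_of_boundary hN _ hκ hr.le hunit hB fun Ψ hΨ hk => ?_
    simp_rw [hmax Ψ hΨ]
    rw [Finset.sum_sub_distrib]
    obtain ⟨Ψ', hΨ'F, hclose⟩ := hFnet Ψ ⟨hΨ, hk⟩
    have h1 := hpos Ψ' hΨ'F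
    have hΨ'b := hFB Ψ' hΨ'F
    have h2 : ∑ n, (gap S Φ Ψ' (x n ω) - gap S Φ Ψ (x n ω)) ≤ N * (lam * D / 8) := by
      have h3 : ∀ n ∈ (univ : Finset (Fin N)),
          gap S Φ Ψ' (x n ω) - gap S Φ Ψ (x n ω) ≤ lam * D / 8 := by
        intro n _
        obtain ⟨hx1, I, hI, hx, -⟩ := hω n
        refine (gap_sub_gap_le hframe hκ (hB Ψ hΨ) (hB Ψ' hΨ'b.1) hh0.le hclose hI hx hx1).trans
          (le_of_eq ?_)
        rw [← hσ, hh]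
        field_simp
        ring
      refine (Finset.sum_le_sum h3).trans (le_of_eq ?_)
      simp
    rw [Finset.sum_sub_distrib] at h2
    have h4 : N * (lam * D / 8) ≤ N * (lam * drift S Φ Ψ' / 8) := by
      gcongr; exact hdrift Ψ' hΨ'b
    linarith
  calc P _ ≤ P (⋃ Ψ ∈ F, bad Ψ) := measure_mono_ae hsub
    _ ≤ ∑ Ψ ∈ F, P (bad Ψ) := measure_biUnion_finset_le F bad
    _ ≤ ∑ _Ψ ∈ F, ENNReal.ofReal E := Finset.sum_le_sum hbad
    _ = #F * ENNReal.ofReal E := by rw [Finset.sum_const, nsmul_eq_mul]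
    _ = ENNReal.ofReal (#F * E) := by
        rw [ENNReal.ofReal_mul (by positivity), ENNReal.ofReal_natCast]
    _ ≤ _ := by
        refine ENNReal.ofReal_le_ofReal ?_
        gcongr
        exact_mod_cast hFcard

end


/-! ### Constants -/

theorem IsTightFrame.one_le {d K : ℕ} {Φ : Dict d K} {A : ℝ} (hframe : IsTightFrame Φ A)
    (hunit : Φ ∈ admissible d K) (k : Fin K) : 1 ≤ A := by
  have h := hframe.2 (Φ k)
  have h1 : (inner ℝ (Φ k) (Φ k)) ^ 2 ≤ ∑ i, (inner ℝ (Φ i) (Φ k)) ^ 2 :=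
    Finset.single_le_sum (f := fun i => (inner ℝ (Φ i) (Φ k)) ^ 2) (fun i _ => sq_nonneg _)
      (Finset.mem_univ k)
  rw [h, real_inner_self_eq_norm_sq, hunit k] at h1
  simpa using h1

theorem lowerIsometry_nonneg {d K S : ℕ} {Φ : Dict d K} (hS : 1 ≤ S)
    (hunit : Φ ∈ admissible d K) (k : Fin K) : 0 ≤ lowerIsometry Φ S := by
  classical
  have hle : lambdaMin Φ {k} ≤ 1 := by
    have htr := (Matrix.isHermitian_gram (𝕜 := ℝ)
      fun i : ({k} : Finset (Fin K)) => Φ i).trace_eq_sum_eigenvalues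
    have hk : k ∈ ({k} : Finset (Fin K)) := Finset.mem_singleton_self k
    have huniv : (univ : Finset ({k} : Finset (Fin K))) = {⟨k, hk⟩} :=
      Finset.eq_singleton_iff_unique_mem.2
        ⟨Finset.mem_univ _, fun i _ => Subtype.ext (Finset.mem_singleton.1 i.2)⟩
    rw [Matrix.trace, huniv, Finset.sum_singleton, Finset.sum_singleton, Matrix.diag_apply,
      Matrix.gram_apply, real_inner_self_eq_norm_sq, hunit k] at htr
    refine (ciInf_le (Set.finite_range _).bddBelow ⟨k, hk⟩).trans (le_of_eq ?_)
    simpa using htr.symm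
  have h := le_ciSup (f := fun I : {I : Finset (Fin K) // I.Nonempty ∧ #I ≤ S} =>
    1 - lambdaMin Φ I.1) (Set.finite_range _).bddAbove
    ⟨{k}, Finset.singleton_nonempty k, by simpa using hS⟩
  exact le_trans (by simpa using hle) h

theorem constC_mul_sq_le_one {d K S : ℕ} {Φ : Dict d K} (hd : 0 < d) (hSd : S ≤ d)
    (h0 : 0 < 1 - lowerIsometry Φ S) (h1 : 1 - lowerIsometry Φ S ≤ 1) :
    constC Φ S * (1 - lowerIsometry Φ S) ^ 2 ≤ 1 := by
  set δ := 1 - lowerIsometry Φ S with hδ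
  have hd0 : (0 : ℝ) < d := by exact_mod_cast hd
  have h2 : (S : ℝ) / d ≤ 1 := by
    rw [div_le_one hd0]; exact_mod_cast hSd
  have h3 : 0 ≤ (S : ℝ) / d := by positivity
  have : constC Φ S * δ ^ 2 = (δ - S / d) ^ 2 := by
    rw [constC, ← hδ]
    field_simp
  rw [this, ← sq_abs]
  refine pow_le_one₀ (abs_nonneg _) (abs_le.2 ⟨by linarith, by linarith⟩)

theorem HasLocalOptimumWithin.mono {d K N S : ℕ} {Y : Fin N → Euc d} {Φ : Dict d K} {r r' : ℝ}
    (h : HasLocalOptimumWithin S Y Φ r) (hr : r ≤ r') : HasLocalOptimumWithin S Y Φ r' := by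
  obtain ⟨Ψ, h1, h2, h3⟩ := h
  exact ⟨Ψ, h1, fun k => (h2 k).trans hr, h3⟩

/-- The side of the grid is polynomial in `X`. -/
theorem two_mul_ceil_add_one_le {A K S σ sd sK lam κ ρ X : ℝ} (hX2 : 2 ≤ X)
    (hA0 : 0 ≤ A) (hA : A ≤ X) (hK0 : 0 ≤ K) (hK : K ≤ X) (hS0 : 0 ≤ S) (hS : S ≤ X)
    (hσ0 : 0 ≤ σ) (hσ : σ ≤ X) (hsd0 : 0 ≤ sd) (hsd : sd ≤ X) (hsK : sK ≤ X) (hsK0 : 0 < sK)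
    (hlam0 : 0 < lam) (hlam : 1 / lam ≤ X) (hκ0 : 0 < κ) (hκ1 : κ ≤ 1) (hρκ : 68 * ρ ≤ κ ^ 2)
    (hρ0 : 0 < ρ) (hρ : 1 / ρ ≤ X) :
    (2 * ⌈128 * A * K * S * σ * sd / (3 * lam * κ ^ 3 * (ρ / sK))⌉₊ + 1 : ℝ) ≤ X ^ 10 := by
  set W := 128 * A * K * S * σ * sd / (3 * lam * κ ^ 3 * (ρ / sK)) with hW
  have hX0 : 0 ≤ X := by linarith
  have hW0 : 0 ≤ W := by positivity
  have hκ3 : 1 / κ ^ 3 ≤ X ^ 2 / 4624 := by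
    have h1 : (68 * ρ) ^ 2 ≤ κ ^ 3 := by
      calc (68 * ρ) ^ 2 ≤ (κ ^ 2) ^ 2 := by gcongr
        _ = κ ^ 3 * κ := by ring
        _ ≤ κ ^ 3 * 1 := by gcongr
        _ = κ ^ 3 := mul_one _
    calc 1 / κ ^ 3 ≤ 1 / (68 * ρ) ^ 2 := by gcongr
      _ = (1 / ρ) ^ 2 / 4624 := by field_simp; norm_num
      _ ≤ X ^ 2 / 4624 := by gcongr
  have hWX : W ≤ X ^ 10 / 100 := by
    calc W = 128 / 3 * (A * K * S * σ * sd * sK * (1 / lam) * (1 / κ ^ 3) * (1 / ρ)) := by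
          rw [hW]; field_simp
      _ ≤ 128 / 3 * (X * X * X * X * X * X * X * (X ^ 2 / 4624) * X) := by gcongr
      _ = 128 / 3 / 4624 * X ^ 10 := by ring
      _ ≤ 1 / 100 * X ^ 10 := mul_le_mul_of_nonneg_right (by norm_num) (by positivity)
      _ = X ^ 10 / 100 := by ring
  have h10 : (2 : ℝ) ^ 10 ≤ X ^ 10 := by gcongr
  have := Nat.ceil_lt_add_one hW0
  linarith

theorem one_add_half_le_log {A lam : ℝ} {K S : ℕ} (hK : 2 ≤ K) (hA1 : 1 ≤ A) (hlam0 : 0 < lam)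
    (hlam1 : lam ≤ 1) : 1 + (S : ℝ) / 2 ≤ Real.log (5 * A * (K : ℝ) ^ S / lam) := by
  have hK2 : (2 : ℝ) ≤ K := by exact_mod_cast hK
  have h5 : (1 : ℝ) ≤ Real.log 5 := by
    rw [Real.le_log_iff_exp_le (by norm_num)]
    linarith [Real.exp_one_lt_d9]
  have h2 := Real.log_two_gt_d9
  have hS0 : (0 : ℝ) ≤ S := by positivity
  calc 1 + (S : ℝ) / 2 ≤ Real.log 5 + S * Real.log 2 := by nlinarith
    _ = Real.log (5 * 2 ^ S) := by
        rw [Real.log_mul (by norm_num) (by positivity), Real.log_pow]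
    _ ≤ _ := by
        refine Real.log_le_log (by positivity) ?_
        rw [le_div_iff₀ hlam0]
        calc (5 : ℝ) * 2 ^ S * lam ≤ 5 * K ^ S * 1 := by gcongr
          _ = 5 * 1 * K ^ S := by ring
          _ ≤ 5 * A * K ^ S := by gcongr

/-- The exponent of the asserted bound, against the one that the radius `ρ / √K` gives. -/
theorem eleven_mul_exponent_le {N K S A ρ L δ CS κ lam r : ℝ} (hN0 : 0 < N)
    (hK0 : 0 < K) (hA0 : 0 < A) (hS0 : 0 < S) (hρ0 : 0 < ρ) (hLsq : S ≤ L ^ 2) (hL0 : 0 < L)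
    (hC0 : 0 ≤ CS) (hCδ : CS * δ ^ 2 ≤ 1) (hρδ : ρ * (68 * √S * L) ≤ κ ^ 2 * δ)
    (hr : r = ρ / √K) :
    11 * (N * ρ ^ 4 * lam ^ 2 * S ^ 2 * CS / (4 * K ^ 2 * A)) ≤
      N * (3 * lam ^ 2 * κ ^ 4 * r ^ 2 / (256 * K * A)) := by
  have hsq : ρ ^ 2 * (4624 * S * L ^ 2) ≤ κ ^ 4 * δ ^ 2 := by
    have h := pow_le_pow_left₀ (by positivity) hρδ 2
    calc ρ ^ 2 * (4624 * S * L ^ 2) = (ρ * (68 * √S * L)) ^ 2 := by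
          rw [mul_pow, mul_pow, mul_pow, Real.sq_sqrt hS0.le]; ring
      _ ≤ (κ ^ 2 * δ) ^ 2 := h
      _ = κ ^ 4 * δ ^ 2 := by ring
  have hκ4 : 0 ≤ κ ^ 4 := by positivity
  have hkey : 4624 * (ρ ^ 2 * S ^ 2 * CS) ≤ κ ^ 4 := by
    calc 4624 * (ρ ^ 2 * S ^ 2 * CS) = ρ ^ 2 * (4624 * S * S) * CS := by ring
      _ ≤ ρ ^ 2 * (4624 * S * L ^ 2) * CS := by gcongr
      _ ≤ κ ^ 4 * δ ^ 2 * CS := by gcongr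
      _ = κ ^ 4 * (CS * δ ^ 2) := by ring
      _ ≤ κ ^ 4 * 1 := by gcongr
      _ = κ ^ 4 := mul_one _
  have hr2 : r ^ 2 = ρ ^ 2 / K := by rw [hr, div_pow, Real.sq_sqrt hK0.le]
  have hG' : N * (3 * lam ^ 2 * κ ^ 4 * r ^ 2 / (256 * K * A)) =
      N * ρ ^ 2 * lam ^ 2 / (K ^ 2 * A) * (3 / 256 * κ ^ 4) := by
    rw [hr2]; field_simp
  have hE' : 11 * (N * ρ ^ 4 * lam ^ 2 * S ^ 2 * CS / (4 * K ^ 2 * A)) =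
      N * ρ ^ 2 * lam ^ 2 / (K ^ 2 * A) * (11 / 4 * (ρ ^ 2 * S ^ 2 * CS)) := by
    field_simp
  rw [hG', hE']
  exact mul_le_mul_of_nonneg_left (by linarith) (by positivity)

/-- At the radius `r = ρ / √K` all `S + 1` atoms stay independent, and no optimal index set
changes. -/
theorem radius_conditions {A κ ρ r : ℝ} {K S : ℕ} (hS : 1 ≤ S) (hSK : S < K) (hAK : A ≤ K)
    (hρ0 : 0 < ρ) (hκ0 : 0 < κ) (hκ1 : κ ≤ 1) (hρS : 68 * (ρ * √(S : ℝ)) ≤ κ ^ 2)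
    (hr : r = ρ / √(K : ℝ)) :
    r ≤ ρ ∧ κ + r * √((S + 1 : ℕ) : ℝ) ≤ √2 * κ ∧
      2 * r * √((S + 1 : ℕ) : ℝ) * √A ≤ κ ^ 2 := by
  have hS1 : (1 : ℝ) ≤ S := by exact_mod_cast hS
  have hSK1 : (S : ℝ) + 1 ≤ K := by exact_mod_cast hSK
  set σS := √(S : ℝ) with hσS
  have hσS1 : 1 ≤ σS := Real.one_le_sqrt.2 hS1
  have hσS2 : σS ^ 2 = S := Real.sq_sqrt (by positivity)
  set sK := √(K : ℝ) with hsK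
  have hsK1 : 1 ≤ sK := Real.one_le_sqrt.2 (by linarith)
  set σ := √((S + 1 : ℕ) : ℝ) with hσ
  have hσ0 : 0 ≤ σ := Real.sqrt_nonneg _
  have hσK : σ ≤ sK := Real.sqrt_le_sqrt (by push_cast; exact hSK1)
  have hσ2 : σ ≤ 2 * σS := by
    refine Real.sqrt_le_iff.2 ⟨by positivity, ?_⟩
    rw [mul_pow, hσS2]; push_cast; linarith
  have hsA : √A ≤ sK := Real.sqrt_le_sqrt hAK
  have hr0 : 0 < r := by rw [hr]; positivity
  have hrsK : r * sK = ρ := by rw [hr]; field_simp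
  have hρκ : 68 * ρ ≤ κ ^ 2 := by nlinarith
  refine ⟨hr ▸ div_le_self hρ0.le hsK1, ?_, ?_⟩
  · have h1 : r * σ ≤ ρ := by rw [← hrsK]; gcongr
    have h2 : (1.4 : ℝ) ≤ √2 := Real.le_sqrt_of_sq_le (by norm_num)
    nlinarith
  · calc 2 * r * σ * √A ≤ 2 * r * (2 * σS) * sK := by gcongr
      _ = 4 * ((r * sK) * σS) := by ring
      _ = 4 * (ρ * σS) := by rw [hrsK]
      _ ≤ κ ^ 2 := by
        have : 0 ≤ ρ * σS := by positivity
        linarith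

end KSVD

theorem mainTheorem2 {d K S N : ℕ} (hS : 1 ≤ S) (hSK : S < K) (hN : 1 ≤ N)
    (Φ : KSVD.Dict d K) (hunit : Φ ∈ KSVD.admissible d K)
    (A : ℝ) (hA : A = (K : ℝ) / (d : ℝ)) (hframe : KSVD.IsTightFrame Φ A)
    (ν : Measure (KSVD.Euc K)) [IsProbabilityMeasure ν]
    (hsphere : ∀ᵐ x ∂ν, ‖x‖ = 1) (hsymm : KSVD.IsSymmetric ν)
    (κ : ℝ) (hκ : 0 < κ) (hmargin : KSVD.HasMargin Φ S ν κ)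
    {Ω : Type*} [MeasurableSpace Ω] (P : Measure Ω) [IsProbabilityMeasure P]
    (x : Fin N → Ω → KSVD.Euc K) (hlaw : ∀ n, HasLaw (x n) ν P) (hindep : iIndepFun x P)
    (q : ℝ) (hq0 : 0 < q) (hq : q < 1 / 4)
    (hsize : (N : ℝ) ^ (-q) + (N : ℝ) ^ (-(2 * q)) / (K : ℝ) ≤
      κ ^ 2 * (1 - KSVD.lowerIsometry Φ S) /
        (68 * √(S : ℝ) * Real.log (5 * A * (K : ℝ) ^ S / KSVD.lambdaS ν S))) :
    P {ω | ¬ KSVD.HasLocalOptimumWithin S (fun n => KSVD.synth Φ (x n ω)) Φ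
        (2 * (N : ℝ) ^ (-q))} ≤
      ENNReal.ofReal (Real.exp
        (-((N : ℝ) ^ (1 - 4 * q) * KSVD.lambdaS ν S ^ 2 * (S : ℝ) ^ 2 * KSVD.constC Φ S
            / (4 * (K : ℝ) ^ 2 * A))
          + (K : ℝ) * (d : ℝ) *
            Real.log ((N : ℝ) * (K : ℝ) * A / (KSVD.lambdaS ν S * (S : ℝ))))) := by
  have hS1 : (1 : ℝ) ≤ S := by exact_mod_cast hS
  have hSK1 : (S : ℝ) + 1 ≤ K := by exact_mod_cast hSK
  have hK0 : (0 : ℝ) < K := by linarith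
  have hN1 : (1 : ℝ) ≤ N := by exact_mod_cast hN
  have hN0 : (0 : ℝ) < N := by linarith
  have hA1 : 1 ≤ A := hframe.one_le hunit ⟨0, by omega⟩
  have hA0 : 0 < A := by linarith
  have hd : 0 < d := by
    rcases Nat.eq_zero_or_pos d with rfl | h
    · simp at hA; linarith
    · exact h
  have hd0 : (0 : ℝ) < d := by exact_mod_cast hd
  have hAd : A * d = K := by rw [hA]; field_simp
  have hdK : (d : ℝ) ≤ K := hAd ▸ le_mul_of_one_le_left hd0.le hA1
  have hAK : A ≤ K := by
    have : (1 : ℝ) ≤ d := by exact_mod_cast hd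
    rw [← hAd]
    exact le_mul_of_one_le_right hA0.le this
  have hSd : S ≤ d := by
    obtain ⟨J, -, hJ⟩ := Finset.exists_subset_card_eq
      (s := (univ : Finset (Fin K))) (n := S) (by simp; omega)
    rw [← KSVD.finrank_atomSpan_eq_of_margin hS hSK hframe hκ hmargin hsphere hsymm hJ]
    simpa using Submodule.finrank_le (KSVD.atomSpan Φ J)
  have hlam4 : 4 * κ ^ 2 ≤ KSVD.lambdaS ν S :=
    KSVD.four_mul_sq_le_lambdaS hS hSK hunit hframe hκ hmargin hsphere hsymm
  have hlam1 : KSVD.lambdaS ν S * S ≤ 1 := KSVD.lambdaS_mul_le_one hS hSK hκ hmargin hsphere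
  have hδ1 : 1 - KSVD.lowerIsometry Φ S ≤ 1 := by
    linarith [KSVD.lowerIsometry_nonneg hS hunit (⟨0, by omega⟩ : Fin K)]
  have hbound := fun r hr hr1 h1 h2 => KSVD.measure_not_hasLocalOptimumWithin_le (r := r) hS hSK hN
    hunit hA hframe hκ hmargin hsphere hsymm hlaw hindep hr hr1 h1 h2
  have hCδ := fun h => KSVD.constC_mul_sq_le_one (Φ := Φ) hd hSd h hδ1
  have hC0 : 0 ≤ KSVD.constC Φ S := sq_nonneg _
  set lam := KSVD.lambdaS ν S with hlam
  set δ := 1 - KSVD.lowerIsometry Φ S with hδ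
  set CS := KSVD.constC Φ S with hCS
  have hκ0 : 0 < κ ^ 2 := by positivity
  have hlam0 : 0 < lam := by linarith
  have hlamle : lam ≤ 1 := (le_mul_of_one_le_right hlam0.le hS1).trans hlam1
  have hκ1 : κ ≤ 1 := (sq_le_one_iff₀ hκ.le).1 (by linarith)
  set ρ := (N : ℝ) ^ (-q) with hρ
  have hρ0 : 0 < ρ := Real.rpow_pos_of_pos hN0 _
  have hρ1 : ρ ≤ 1 := Real.rpow_le_one_of_one_le_of_nonpos hN1 (by linarith)
  set L := Real.log (5 * A * (K : ℝ) ^ S / lam) with hL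
  have hLS : 1 + (S : ℝ) / 2 ≤ L := KSVD.one_add_half_le_log (by omega) hA1 hlam0 hlamle
  have hL1 : 1 ≤ L := by linarith
  have hLsq : (S : ℝ) ≤ L ^ 2 := by
    have h1 := pow_le_pow_left₀ (by positivity) hLS 2
    have h2 : (1 + (S : ℝ) / 2) ^ 2 = 1 + S + ((S : ℝ) / 2) ^ 2 := by ring
    linarith [sq_nonneg ((S : ℝ) / 2)]
  set σS := √(S : ℝ) with hσS
  have hσS1 : 1 ≤ σS := Real.one_le_sqrt.2 hS1
  have hσS2 : σS ^ 2 = S := Real.sq_sqrt (by positivity)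
  -- The size condition bounds `ρ = N ^ (-q)`; it also forces `δ` to be positive.
  have hρδ : ρ * (68 * σS * L) ≤ κ ^ 2 * δ := by
    rw [← le_div_iff₀ (by positivity)]
    refine le_trans ?_ hsize
    have : (0 : ℝ) ≤ (N : ℝ) ^ (-(2 * q)) / K := by positivity
    linarith
  have hδ0 : 0 < δ := by
    have h1 : 0 < ρ * (68 * σS * L) := by positivity
    exact pos_of_mul_pos_right (h1.trans_le hρδ) hκ0.le
  have hρS : 68 * (ρ * σS) ≤ κ ^ 2 := by
    calc 68 * (ρ * σS) = ρ * (68 * σS * 1) := by ring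
      _ ≤ ρ * (68 * σS * L) := by gcongr
      _ ≤ κ ^ 2 * δ := hρδ
      _ ≤ κ ^ 2 * 1 := by gcongr
      _ = κ ^ 2 := mul_one _
  have hρκ : 68 * ρ ≤ κ ^ 2 :=
    (mul_le_mul_of_nonneg_left (le_mul_of_one_le_right hρ0.le hσS1) (by norm_num)).trans hρS
  -- The radius `ρ / √K` is so small that no optimal index set changes.
  set sK := √(K : ℝ) with hsK
  have hsK0 : 0 < sK := Real.sqrt_pos.2 hK0
  set σ := √((S + 1 : ℕ) : ℝ) with hσ
  have hσK : σ ≤ sK := Real.sqrt_le_sqrt (by push_cast; exact hSK1)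
  set r := ρ / sK with hr
  have hr0 : 0 < r := by positivity
  obtain ⟨hrρ, hrκ, hrA⟩ := KSVD.radius_conditions hS hSK hAK hρ0 hκ hκ1 hρS hr
  have hmain := hbound r hr0 (hrρ.trans hρ1) hrκ hrA
  set X := (N : ℝ) * (K : ℝ) * A / (lam * (S : ℝ)) with hX
  -- The base `X` of the entropy term dominates every constant in the size of the net.
  have hlamS0 : 0 < lam * S := by positivity
  have hNKX : (N : ℝ) * K * A ≤ X := by
    rw [hX, le_div_iff₀ hlamS0]
    have : 0 ≤ (N : ℝ) * K * A := by positivity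
    exact mul_le_of_le_one_right this hlam1
  have hKX : (K : ℝ) ≤ X := by
    refine le_trans ?_ hNKX
    calc (K : ℝ) = 1 * K * 1 := by ring
      _ ≤ N * K * A := by gcongr
  have hNX : (N : ℝ) ≤ X := by
    refine le_trans ?_ hNKX
    calc (N : ℝ) = N * 1 * 1 := by ring
      _ ≤ N * K * A := by gcongr; linarith
  have hX2 : 2 ≤ X := by linarith
  have hlamX : 1 / lam ≤ X := by
    rw [hX, div_le_div_iff₀ hlam0 hlamS0]
    have h1 : (S : ℝ) ≤ N * K * A := by
      calc (S : ℝ) ≤ 1 * K * 1 := by linarith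
        _ ≤ N * K * A := by gcongr
    rw [one_mul, mul_comm lam]
    exact mul_le_mul_of_nonneg_right h1 hlam0.le
  have hρX : 1 / ρ ≤ X := by
    refine le_trans ?_ hNX
    rw [hρ, Real.rpow_neg hN0.le, one_div, inv_inv]
    calc (N : ℝ) ^ q ≤ (N : ℝ) ^ (1 : ℝ) := Real.rpow_le_rpow_of_exponent_le hN1 (by linarith)
      _ = N := Real.rpow_one _
  have hsqrt : ∀ z : ℝ, 1 ≤ z → √z ≤ z := fun z hz =>
    Real.sqrt_le_iff.2 ⟨by linarith, by rw [sq]; exact le_mul_of_one_le_left (by linarith) hz⟩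
  have hsKX : sK ≤ X := (hsqrt K (by linarith)).trans hKX
  have hsdX : √(d : ℝ) ≤ X := (Real.sqrt_le_sqrt hdK).trans hsKX
  have hnet := KSVD.two_mul_ceil_add_one_le hX2 hA0.le (hAK.trans hKX) hK0.le hKX
    (by positivity : (0 : ℝ) ≤ S) (by linarith) (Real.sqrt_nonneg _) (hσK.trans hsKX)
    (Real.sqrt_nonneg _) hsdX hsKX hsK0 hlam0 hlamX hκ hκ1 hρκ hρ0 hρX
  set Λ := (K : ℝ) * d * Real.log X with hΛ
  have hΛ0 : 0 ≤ Λ := mul_nonneg (by positivity) (Real.log_nonneg (by linarith))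
  set E := (N : ℝ) ^ (1 - 4 * q) * lam ^ 2 * (S : ℝ) ^ 2 * CS / (4 * (K : ℝ) ^ 2 * A) with hE
  have hE0 : 0 ≤ E := by positivity
  set G := (N : ℝ) * (3 * lam ^ 2 * κ ^ 4 * r ^ 2 / (256 * K * A)) with hG
  have hEG : 11 * E ≤ G := by
    have hpow : (N : ℝ) ^ (1 - 4 * q) = N * ρ ^ 4 := by
      rw [sub_eq_add_neg, Real.rpow_add hN0, Real.rpow_one, hρ, ← Real.rpow_natCast,
        ← Real.rpow_mul hN0.le]
      congr 2
      push_cast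
      ring
    rw [hE, hpow]
    exact KSVD.eleven_mul_exponent_le hN0 hK0 hA0 (by linarith) hρ0 hLsq (by linarith) hC0
      (hCδ hδ0) hρδ hr
  rcases le_or_gt E Λ with hcase | hcase
  · -- The asserted bound is at least `1`.
    refine prob_le_one.trans ?_
    rw [ENNReal.one_le_ofReal]
    exact Real.one_le_exp (by linarith)
  · refine (measure_mono ?_).trans (hmain.trans (ENNReal.ofReal_le_ofReal ?_))
    · intro ω hω hloc
      exact hω (hloc.mono (by linarith))
    · calc _ ≤ (X ^ 10) ^ (K * d) * Real.exp (-G) := by gcongr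
        _ = Real.exp (10 * Λ) * Real.exp (-G) := by
            congr 1
            rw [← Real.rpow_natCast, ← Real.rpow_natCast, ← Real.rpow_mul (by linarith),
              Real.rpow_def_of_pos (by linarith), hΛ]
            congr 1
            push_cast
            ring
        _ = Real.exp (10 * Λ - G) := by rw [← Real.exp_add, sub_eq_add_neg]
        _ ≤ Real.exp (-E + Λ) := Real.exp_le_exp.2 (by linarith)
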